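/- Let $H:\mathbb R^d\to\mathbb R$ be continuous and let $u_0:\mathbb R^d\to\mathbb R$ be Lipschitz and concave. Let $u_0^*(p):=\inf_{x}(p\cdot x-u_0(x))\in[-\infty,\infty)$ be the concave Legendre dual of $u_0$ and $P:=\{p\in\mathbb R^d: u_0^*(p)>-\infty\}$. Then for all $t\ge 0$, $x\in\mathbb R^d$ the infimum $$u(t,x):=\min_{p\in P}\big(p\cdot x-u_0^*(p)-tH(p)\big)$$ is attained, $u(0,\cdot)=u_0$, and $u$ is a viscosity solution of $$\partial_t u+H(\partial_x u)=0\qquad(\mathrm{HJ})$$ on $[0,\infty)\times\mathbb R^d$; that is, $u$ is continuous there, and every smooth function $\phi$ which has a local contact from above (resp. from below) with $u$ at a point $(t_0,x_0)$, $t_0>0$, satisfies $\partial_t\phi+H(\partial_x\phi)\le 0$ (resp. $\ge 0$) at $(t_0,x_0)$. Assume in addition that $H$ is $C^2$ and that for a constant $A$ one has $|d^2H(p)|\le A$, $|dH(p)|\le A(1+|p|)$ and $|H(p)|\le A(1+|p|)^2$ for all $p$. Then $v=g=u$ on $[0,\infty)\times\mathbb R^d$, where $v$ is the viscosity solution and $g$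 the variational solution with initial condition $u_0$ at time $0$. Precisely: (a) $u$ is the unique viscosity solution $w$ of (HJ) on $[0,\infty)\times\mathbb R^d$ such that $w(0,\cdot)=u_0$ and such that $w(t,x)-u_0(x)$ is bounded and Lipschitz on $(0,T)\times\mathbb R^d$ for each $T>0$. (b) Consider families $R_s^t$, $s\le t$, of operators from the space of Lipschitz functions on $\mathbb R^d$ to itself such that (1) $\mathrm{Lip}(R_s^tf)\le(\mathrm{Lip}(f)+1)e^{A(t-s)}-1$ and $\|R_s^tf-f\|_\infty\le A(t-s)\big((\mathrm{Lip}(f)+1)e^{A(t-s)}\big)^2$; (2) $f_1\le f_2\Rightarrow R_s^tf_1\le R_s^tf_2$; (3) if $f$ is a $C^2$ solution of (HJ) on $(T^-,T^+)\times\mathbb R^d$ with Lipschitz time slices $f_\tau=f(\tau,\cdot)$, then $R_s^tf_s=f_t$ for $T^-<s\le t<T^+$. If $V=R$ satisfies (1)–(3) and $V_s^t\circ V_r^s=V_r^t$ for $r\le s\le t$, then $v(t,x):=V_0^tu_0(x)$ equals $u(t,x)$ for all $t\ge0$, $x\in\mathbb R^d$. (c) If $G=R$ satisfies (1)–(3)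 and, for all $s$ and all Lipschitz $f$, the function $(t,x)\mapsto G_s^tf(x)$ is a variational solution on $[s,\infty)\times\mathbb R^d$ with initial condition $f$ at time $s$, then $g(t,x):=G_0^tu_0(x)$ equals $u(t,x)$ for all $t\ge0$, $x\in\mathbb R^d$. Here a variational solution is a locally Lipschitz function $w$ with $w(s,\cdot)=f$ which solves (HJ) almost everywhere and such that for all $t>s$ and $x$ there is a trajectory $(q,p):[s,t]\to\mathbb R^d\times\mathbb R^d$ of the Hamiltonian system $\dot q=\nabla H(p)$, $\dot p=0$, with $q(t)=x$, with $p(s)$ in the Clarke differential of $f$ at $q(s)$, and with $w(t,x)=f(q(s))+\int_s^t\big(p\cdot\dot q-H(p)\big)\,d\tau$. -/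

import Mathlib

open Set Filter Topology MeasureTheory
open scoped NNReal ContDiff

/-- The Euclidean space `ℝ^d`. -/
abbrev Space (d : ℕ) : Type := EuclideanSpace ℝ (Fin d)

/-- `C^{0,1}(ℝ^d)`: the (globally) Lipschitz real functions on `ℝ^d`. -/
abbrev LipFun (d : ℕ) : Type := {u : Space d → ℝ // ∃ K : ℝ≥0, LipschitzWith K u}

/-- The partial derivative `∂_t f (t, x)`. -/
noncomputable def partialTime {d : ℕ} (f : ℝ → Space d → ℝ) (t : ℝ) (x : Space d) : ℝ :=
  deriv (fun τ => f τ x) t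

/-- The partial derivative `∂_x f (t, x)`, as a vector. -/
noncomputable def partialSpace {d : ℕ} (f : ℝ → Space d → ℝ) (t : ℝ) (x : Space d) : Space d :=
  gradient (f t) x

/-- `H` is `C^2` with `|d²H| ≤ A`, `|dH| ≤ A (1 + |p|)` and `|H| ≤ A (1 + |p|)²`. -/
structure HamiltonianBounds {d : ℕ} (H : ℝ → Space d → Space d → ℝ) (A : ℝ) : Prop where
  contDiff : ContDiff ℝ 2 (fun z : ℝ × Space d × Space d => H z.1 z.2.1 z.2.2)
  second : ∀ z : ℝ × Space d × Space d,
    ‖fderiv ℝ (fderiv ℝ (fun y : ℝ × Space d × Space d => H y.1 y.2.1 y.2.2)) z‖ ≤ A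
  first : ∀ z : ℝ × Space d × Space d,
    ‖fderiv ℝ (fun y : ℝ × Space d × Space d => H y.1 y.2.1 y.2.2) z‖ ≤ A * (1 + ‖z.2.2‖)
  zeroth : ∀ (t : ℝ) (x p : Space d), |H t x p| ≤ A * (1 + ‖p‖) ^ 2

/-- `f` is a `C^2` solution of `∂_t f + H(t, x, ∂_x f) = 0` on `]T₁, T₂[ × ℝ^d`. -/
structure IsClassicalSolution {d : ℕ} (H : ℝ → Space d → Space d → ℝ) (T₁ T₂ : ℝ)
    (f : ℝ → Space d → ℝ) : Prop where
  contDiffOn : ContDiffOn ℝ 2 (fun z : ℝ × Space d => f z.1 z.2) (Ioo T₁ T₂ ×ˢ univ)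
  equation : ∀ t ∈ Ioo T₁ T₂, ∀ x : Space d,
    partialTime f t x + H t x (partialSpace f t x) = 0

/-- `u` is a continuous viscosity solution of `∂_t u + H(t, x, ∂_x u) = 0` on
`[0, ∞[ × ℝ^d`: it is continuous there, and smooth functions in contact with `u` from above
(from below) at points of `]0, ∞[ × ℝ^d` satisfy the inequality `≤ 0` (`≥ 0`). -/
structure IsViscositySolution {d : ℕ} (H : ℝ → Space d → Space d → ℝ)
    (u : ℝ → Space d → ℝ) : Prop where
  continuousOn : ContinuousOn (fun z : ℝ × Space d => u z.1 z.2) (Ici 0 ×ˢ univ)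
  subsolution : ∀ φ : ℝ → Space d → ℝ, ContDiff ℝ ∞ (fun z : ℝ × Space d => φ z.1 z.2) →
    ∀ (t : ℝ) (x : Space d), 0 < t → φ t x = u t x →
      (∀ᶠ z : ℝ × Space d in 𝓝 (t, x), u z.1 z.2 ≤ φ z.1 z.2) →
      partialTime φ t x + H t x (partialSpace φ t x) ≤ 0
  supersolution : ∀ φ : ℝ → Space d → ℝ, ContDiff ℝ ∞ (fun z : ℝ × Space d => φ z.1 z.2) →
    ∀ (t : ℝ) (x : Space d), 0 < t → φ t x = u t x →
      (∀ᶠ z : ℝ × Space d in 𝓝 (t, x), φ z.1 z.2 ≤ u z.1 z.2) →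
      0 ≤ partialTime φ t x + H t x (partialSpace φ t x)

/-- `v` is a viscosity solution on `[0, ∞[ × ℝ^d` with `v(0, ·) = u₀`, such that
`v(t, x) - u₀(x)` is bounded and Lipschitz on `]0, T[ × ℝ^d` for each `T > 0`. -/
structure IsCauchyViscositySolution {d : ℕ} (H : ℝ → Space d → Space d → ℝ)
    (u₀ : Space d → ℝ) (v : ℝ → Space d → ℝ) : Prop where
  viscosity : IsViscositySolution H v
  initial : ∀ x, v 0 x = u₀ x
  bounded : ∀ T : ℝ, 0 < T → ∃ C : ℝ, ∀ t ∈ Ioo 0 T, ∀ x, |v t x - u₀ x| ≤ C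
  lipschitz : ∀ T : ℝ, 0 < T → ∃ K : ℝ≥0,
    LipschitzOnWith K (fun z : ℝ × Space d => v z.1 z.2 - u₀ z.2) (Ioo 0 T ×ˢ univ)

/-- The reachable gradients of `u` at `x`. -/
def reachableGradients {d : ℕ} (u : Space d → ℝ) (x : Space d) : Set (Space d) :=
  {p | ∃ y : ℕ → Space d, (∀ n, DifferentiableAt ℝ u (y n)) ∧ Tendsto y atTop (𝓝 x) ∧
    Tendsto (fun n => gradient u (y n)) atTop (𝓝 p)}

/-- The Clarke differential of a locally Lipschitz function. -/
def clarkeDifferential {d : ℕ} (u : Space d → ℝ) (x : Space d) : Set (Space d) :=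
  convexHull ℝ (reachableGradients u x)

/-- `(q, p)` solves `q' = ∂_p H(t, q, p)`, `p' = - ∂_q H(t, q, p)` on `[s, t]`. -/
def IsHamiltonianTrajectory {d : ℕ} (H : ℝ → Space d → Space d → ℝ) (s t : ℝ)
    (q p : ℝ → Space d) : Prop :=
  ∀ τ ∈ Icc s t,
    HasDerivWithinAt q (gradient (fun ξ => H τ (q τ) ξ) (p τ)) (Icc s t) τ ∧
    HasDerivWithinAt p (-gradient (fun y => H τ y (p τ)) (q τ)) (Icc s t) τ

/-- The action `∫_s^t p · q' - H(τ, q, p) dτ`. -/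
noncomputable def hamiltonianAction {d : ℕ} (H : ℝ → Space d → Space d → ℝ) (s t : ℝ)
    (q p : ℝ → Space d) : ℝ :=
  ∫ τ in s..t, (inner ℝ (p τ) (derivWithin q (Icc s t) τ) - H τ (q τ) (p τ))

/-- `g` is a variational solution on `[s, ∞[ × ℝ^d` with initial condition `u` at time `s`. -/
structure IsVariationalSolution {d : ℕ} (H : ℝ → Space d → Space d → ℝ) (s : ℝ)
    (u : Space d → ℝ) (g : ℝ → Space d → ℝ) : Prop where
  locallyLipschitz :
    LocallyLipschitzOn (Ici s ×ˢ univ) (fun z : ℝ × Space d => g z.1 z.2)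
  initial : ∀ x, g s x = u x
  equation_ae : ∀ᵐ z : ℝ × Space d, s < z.1 →
    DifferentiableAt ℝ (fun y : ℝ × Space d => g y.1 y.2) z ∧
    partialTime g z.1 z.2 + H z.1 z.2 (partialSpace g z.1 z.2) = 0
  critical : ∀ (t : ℝ) (x : Space d), s < t → ∃ q p : ℝ → Space d,
    IsHamiltonianTrajectory H s t q p ∧ q t = x ∧ p s ∈ clarkeDifferential u (q s) ∧
    g t x = u (q s) + hamiltonianAction H s t q p

/-- The properties shared by variational and viscosity resolutions of the Cauchy problem, for
a family `R s t` (`s ≤ t`) of operators on the Lipschitz functions: Lipschitz and uniform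
estimates, monotonicity, and compatibility with `C^2` solutions. -/
structure IsResolution {d : ℕ} (H : ℝ → Space d → Space d → ℝ) (A : ℝ)
    (R : ℝ → ℝ → LipFun d → LipFun d) : Prop where
  lipschitz : ∀ (s t : ℝ), s ≤ t → ∀ (u : LipFun d) (K : ℝ≥0), LipschitzWith K u.1 →
    LipschitzWith (Real.toNNReal ((K + 1) * Real.exp (A * (t - s)) - 1)) (R s t u).1
  close : ∀ (s t : ℝ), s ≤ t → ∀ (u : LipFun d) (K : ℝ≥0), LipschitzWith K u.1 →
    ∀ x, |(R s t u).1 x - u.1 x| ≤ A * (t - s) * ((K + 1) * Real.exp (A * (t - s))) ^ 2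
  monotone : ∀ (s t : ℝ), s ≤ t → ∀ u v : LipFun d, (∀ x, u.1 x ≤ v.1 x) →
    ∀ x, (R s t u).1 x ≤ (R s t v).1 x
  classical : ∀ (T₁ T₂ : ℝ) (f : ℝ → Space d → ℝ), IsClassicalSolution H T₁ T₂ f →
    ∀ hf : ∀ τ ∈ Ioo T₁ T₂, ∃ K : ℝ≥0, LipschitzWith K (f τ),
    ∀ (s t : ℝ) (hs : s ∈ Ioo T₁ T₂), t ∈ Ioo T₁ T₂ → s ≤ t →
    ∀ x, (R s t ⟨f s, hf s hs⟩).1 x = f t x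

/-- Variational resolutions: every `(t, x) ↦ G s t u x` is a variational solution. -/
structure IsVariationalResolution {d : ℕ} (H : ℝ → Space d → Space d → ℝ) (A : ℝ)
    (G : ℝ → ℝ → LipFun d → LipFun d) : Prop extends IsResolution H A G where
  variational : ∀ (s : ℝ) (u : LipFun d),
    IsVariationalSolution H s u.1 (fun t x => (G s t u).1 x)

/-- The viscosity resolution: the Markov property holds in addition. -/
structure IsViscosityResolution {d : ℕ} (H : ℝ → Space d → Space d → ℝ) (A : ℝ)
    (V : ℝ → ℝ → LipFun d → LipFun d) : Prop extends IsResolution H A V where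
  markov : ∀ (r s t : ℝ), r ≤ s → s ≤ t → ∀ u : LipFun d, V s t (V r s u) = V r t u

/-- The domain `P` of the concave Legendre dual: the `p` with `inf_x (p · x - u(x)) > -∞`. -/
def dualDomain {d : ℕ} (u : Space d → ℝ) : Set (Space d) :=
  {p | BddBelow (range fun x => inner ℝ p x - u x)}

/-- The concave Legendre dual `u^*(p) = inf_x (p · x - u(x))`, for `p` in `dualDomain u`. -/
noncomputable def concaveDual {d : ℕ} (u : Space d → ℝ) (p : Space d) : ℝ :=
  ⨅ x, (inner ℝ p x - u x)

/-- The values `p · x - u₀^*(p) - t H(p)`, `p ∈ P`. -/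
def hopfValues {d : ℕ} (H : Space d → ℝ) (u₀ : Space d → ℝ) (t : ℝ) (x : Space d) : Set ℝ :=
  (fun p => inner ℝ p x - concaveDual u₀ p - t * H p) '' dualDomain u₀

/-- The Hopf formula. -/
noncomputable def hopf {d : ℕ} (H : Space d → ℝ) (u₀ : Space d → ℝ) (t : ℝ) (x : Space d) : ℝ :=
  sInf (hopfValues H u₀ t x)

/-!
The Hopf function `u` is a minimum, over `p ∈ P`, of the affine classical solutions
`p · x - u₀^*(p) - t H(p)`. The set `P` is bounded by the Lipschitz constant of `u₀`, which makes
the minimum attained (`exists_isMinOn_hopf`) and `u` Lipschitz and concave in `(t, x)`. A function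
touching `u` from below touches one of the affine solutions, hence the supersolution property. If
`φ` touches `u` from above at `(t, x)`, concavity makes the tangent of `φ` a global majorant of
`u`; at time `0` this says that `p = ∂_x φ` lies in `P` and bounds `u₀^*(p)` from below, and the
Hopf formula with this `p` gives the subsolution property (`hopf_isViscositySolution`).

Uniqueness is the comparison principle `le_of_superjet_of_subjet`, proved by doubling variables.
It is stated for the inequalities at contact with paraboloids only (`HasSuperjet`, `HasSubjet`), so that
it also applies to functions for which just these have been verified.

Every resolution lies below `u`, by monotonicity and its known values on affine solutions
(`IsResolution.le_hopf`). Conversely, the Clarke differential of the concave function `u₀`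
consists of supergradients, and trajectories of `H(p)` are straight lines, so a variational
solution takes at `(t, x)` the value of one of the affine solutions, which is at least `u(t, x)`
(`IsVariationalSolution.hopf_le`). For a viscosity resolution, the comparison principle reduces
`u ≤ v` to the fact that `v` is a supersolution. At a contact point from below, `v` is, slightly
earlier, above a globally Lipschitz `C^2` function (`softCone`); the method of characteristics
(`exists_classicalSolution`) extends this function to a classical solution, which by monotonicity
and the Markov property stays below `v`, and differentiating at the contact point gives the
inequality (`IsViscosityResolution.zero_le_add_of_hasSubjet`).
-/

/-! ### The concave dual and the Hopf formula -/

theorem concaveDual_le {d : ℕ} {u : Space d → ℝ} {p : Space d} (hp : p ∈ dualDomain u)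
    (x : Space d) : concaveDual u p ≤ inner ℝ p x - u x :=
  ciInf_le hp x

theorem mem_dualDomain_of_forall_le {d : ℕ} {u : Space d → ℝ} {p : Space d} {c : ℝ}
    (h : ∀ x, c ≤ inner ℝ p x - u x) : p ∈ dualDomain u := by
  refine ⟨c, ?_⟩
  rintro _ ⟨x, rfl⟩
  exact h x

theorem le_concaveDual {d : ℕ} {u : Space d → ℝ} {p : Space d} {c : ℝ}
    (h : ∀ x, c ≤ inner ℝ p x - u x) : c ≤ concaveDual u p :=
  le_ciInf h

/-- Slopes of affine majorants are bounded by the Lipschitz constant: test `x = -s p`, `s → ∞`. -/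
theorem norm_le_of_mem_dualDomain {d : ℕ} {u : Space d → ℝ} {K : ℝ≥0} (hu : LipschitzWith K u)
    {p : Space d} (hp : p ∈ dualDomain u) : ‖p‖ ≤ K := by
  by_contra! hK
  obtain ⟨m, hm⟩ := hp
  have hp0 : 0 < ‖p‖ := lt_of_le_of_lt K.2 hK
  have key : ∀ s : ℝ, 0 ≤ s → s * (‖p‖ * (‖p‖ - K)) ≤ -m - u 0 := by
    intro s hs
    have h1 : m ≤ inner ℝ p (-(s • p)) - u (-(s • p)) := hm ⟨_, rfl⟩
    have h2 := hu.dist_le_mul (-(s • p)) 0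
    rw [Real.dist_eq, dist_zero_right, norm_neg, norm_smul, Real.norm_of_nonneg hs] at h2
    rw [inner_neg_right, inner_smul_right, real_inner_self_eq_norm_sq] at h1
    have h3 := neg_le_of_abs_le h2
    nlinarith
  have hpos : 0 < ‖p‖ * (‖p‖ - K) := mul_pos hp0 (by linarith)
  have h0 := key 0 le_rfl
  have h1 := key ((-m - u 0 + 1) / (‖p‖ * (‖p‖ - K))) (by
    apply div_nonneg _ hpos.le; linarith)
  rw [div_mul_cancel₀ _ hpos.ne'] at h1
  linarith

theorem exists_abs_le_on_dualDomain {d : ℕ} {H : Space d → ℝ} (hH : Continuous H)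
    {u : Space d → ℝ} {K : ℝ≥0} (hu : LipschitzWith K u) :
    ∃ M : ℝ≥0, ∀ p ∈ dualDomain u, |H p| ≤ M := by
  obtain ⟨C, hC⟩ := (isCompact_closedBall (0 : Space d) K).exists_bound_of_continuousOn
    hH.continuousOn
  refine ⟨C.toNNReal, fun p hp => ?_⟩
  have := hC p (by simpa using norm_le_of_mem_dualDomain hu hp)
  exact this.trans (Real.le_coe_toNNReal C)

/-- The affine majorants `p · x - u^*(p)` of a concave function come arbitrarily close to it at
every point, by Hahn–Banach. -/
theorem exists_mem_dualDomain_lt {d : ℕ} {u : Space d → ℝ} {K : ℝ≥0} (hu : LipschitzWith K u)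
    (hconc : ConcaveOn ℝ univ u) (x : Space d) {b : ℝ} (hb : u x < b) :
    ∃ p ∈ dualDomain u, inner ℝ p x - concaveDual u p ≤ b := by
  obtain ⟨l, c, hle, heq⟩ := ConvexOn.exists_affine_le_of_lt (𝕜 := ℝ) (φ := fun y => -u y)
    (s := univ) (a := -b) (mem_univ x) (by simpa using hb) isClosed_univ
    (hu.continuous.neg.lowerSemicontinuous.lowerSemicontinuousOn _) hconc.neg
  set p : Space d := -(InnerProductSpace.toDual ℝ (Space d)).symm l with hp
  have hinner : ∀ y, inner ℝ p y = -l y := fun y => by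
    rw [hp, inner_neg_left, InnerProductSpace.toDual_symm_apply]
  have hc : ∀ y, c ≤ inner ℝ p y - u y := fun y => by
    have : l y + c ≤ -u y := hle ⟨y, mem_univ y⟩
    rw [hinner]; linarith
  refine ⟨p, mem_dualDomain_of_forall_le hc, ?_⟩
  have h1 := le_concaveDual hc
  have h2 : l x + c = -b := heq
  rw [hinner]; linarith

/-- The infimum in the Hopf formula is attained, at negative times as well: the momenta range
over a bounded set on which `p ↦ -u^*(p)` has closed epigraph. -/
theorem exists_isMinOn_hopf {d : ℕ} {H : Space d → ℝ} (hH : Continuous H) {u : Space d → ℝ}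
    {K : ℝ≥0} (hu : LipschitzWith K u) (hconc : ConcaveOn ℝ univ u) (t : ℝ) (x : Space d) :
    ∃ p ∈ dualDomain u, ∀ q ∈ dualDomain u,
      inner ℝ p x - concaveDual u p - t * H p ≤ inner ℝ q x - concaveDual u q - t * H q := by
  obtain ⟨M, hM⟩ := exists_abs_le_on_dualDomain hH hu
  obtain ⟨p₀, hp₀, -⟩ := exists_mem_dualDomain_lt hu hconc 0 (lt_add_one (u 0))
  have hbdd : BddBelow (hopfValues H u t x) := by
    refine ⟨u x - |t| * M, ?_⟩
    rintro _ ⟨q, hq, rfl⟩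
    have h1 := concaveDual_le hq x
    have h2 : t * H q ≤ |t| * M := (le_abs_self _).trans (by
      rw [abs_mul]; exact mul_le_mul_of_nonneg_left (hM q hq) (abs_nonneg t))
    simp only; linarith
  have hne : (hopfValues H u t x).Nonempty := ⟨_, p₀, hp₀, rfl⟩
  obtain ⟨f, -, hf, hfm⟩ := exists_seq_tendsto_sInf hne hbdd
  choose q hq hqf using hfm
  obtain ⟨p, -, φ, hφ, hlim⟩ := (isCompact_closedBall (0 : Space d) K).tendsto_subseq
    (x := q) (fun n => by simpa using norm_le_of_mem_dualDomain hu (hq n))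
  have hf' : Tendsto (fun n => f (φ n)) atTop (𝓝 (sInf (hopfValues H u t x))) :=
    hf.comp hφ.tendsto_atTop
  -- the inequalities defining `u^*(q (φ n))` pass to the limit, so that `p ∈ dualDomain u`
  have key : ∀ y, inner ℝ p x - t * H p - sInf (hopfValues H u t x) ≤ inner ℝ p y - u y := by
    intro y
    refine le_of_tendsto_of_tendsto' (b := atTop)
      (f := fun n => inner ℝ (q (φ n)) x - t * H (q (φ n)) - f (φ n))
      (g := fun n => inner ℝ (q (φ n)) y - u y) ?_ ?_ ?_
    · exact ((hlim.inner tendsto_const_nhds).sub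
        (((hH.tendsto p).comp hlim).const_mul t)).sub hf'
    · exact (hlim.inner tendsto_const_nhds).sub tendsto_const_nhds
    · intro n
      have h1 := concaveDual_le (hq (φ n)) y
      have h2 := hqf (φ n)
      simp only at h2
      linarith
  refine ⟨p, mem_dualDomain_of_forall_le key, fun r hr => ?_⟩
  have h1 := le_concaveDual key
  have h2 : sInf (hopfValues H u t x) ≤ inner ℝ r x - concaveDual u r - t * H r :=
    csInf_le hbdd ⟨r, hr, rfl⟩
  linarith

theorem isLeast_hopf {d : ℕ} {H : Space d → ℝ} (hH : Continuous H) {u : Space d → ℝ}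
    {K : ℝ≥0} (hu : LipschitzWith K u) (hconc : ConcaveOn ℝ univ u) (t : ℝ) (x : Space d) :
    IsLeast (hopfValues H u t x) (hopf H u t x) := by
  obtain ⟨p, hp, hmin⟩ := exists_isMinOn_hopf hH hu hconc t x
  have : IsLeast (hopfValues H u t x) (inner ℝ p x - concaveDual u p - t * H p) := by
    refine ⟨⟨p, hp, rfl⟩, ?_⟩
    rintro _ ⟨q, hq, rfl⟩
    exact hmin q hq
  rw [hopf, this.csInf_eq]
  exact this

theorem exists_hopf_eq {d : ℕ} {H : Space d → ℝ} (hH : Continuous H) {u : Space d → ℝ}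
    {K : ℝ≥0} (hu : LipschitzWith K u) (hconc : ConcaveOn ℝ univ u) (t : ℝ) (x : Space d) :
    ∃ p ∈ dualDomain u, hopf H u t x = inner ℝ p x - concaveDual u p - t * H p := by
  obtain ⟨p, hp, h⟩ := (isLeast_hopf hH hu hconc t x).1
  exact ⟨p, hp, h.symm⟩

theorem hopf_le {d : ℕ} {H : Space d → ℝ} (hH : Continuous H) {u : Space d → ℝ}
    {K : ℝ≥0} (hu : LipschitzWith K u) (hconc : ConcaveOn ℝ univ u) (t : ℝ) (x : Space d)
    {p : Space d} (hp : p ∈ dualDomain u) :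
    hopf H u t x ≤ inner ℝ p x - concaveDual u p - t * H p :=
  (isLeast_hopf hH hu hconc t x).2 ⟨p, hp, rfl⟩

theorem hopf_zero {d : ℕ} {H : Space d → ℝ} (hH : Continuous H) {u : Space d → ℝ}
    {K : ℝ≥0} (hu : LipschitzWith K u) (hconc : ConcaveOn ℝ univ u) (x : Space d) :
    hopf H u 0 x = u x := by
  apply le_antisymm
  · refine le_of_forall_gt_imp_ge_of_dense fun b hb => ?_
    obtain ⟨p, hp, h⟩ := exists_mem_dualDomain_lt hu hconc x hb
    have := hopf_le hH hu hconc 0 x hp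
    linarith
  · obtain ⟨p, hp, h⟩ := exists_hopf_eq hH hu hconc 0 x
    have := concaveDual_le hp x
    linarith

theorem hopf_sub_le {d : ℕ} {H : Space d → ℝ} (hH : Continuous H) {u : Space d → ℝ}
    {K : ℝ≥0} (hu : LipschitzWith K u) (hconc : ConcaveOn ℝ univ u) {M : ℝ≥0}
    (hM : ∀ p ∈ dualDomain u, |H p| ≤ M) (t t' : ℝ) (x x' : Space d) :
    |hopf H u t x - hopf H u t' x'| ≤ M * |t - t'| + K * ‖x - x'‖ := by
  have key : ∀ t t' x x', hopf H u t x - hopf H u t' x' ≤ M * |t - t'| + K * ‖x - x'‖ := by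
    intro t t' x x'
    obtain ⟨p, hp, h⟩ := exists_hopf_eq hH hu hconc t' x'
    have h1 := hopf_le hH hu hconc t x hp
    have h2 : inner ℝ p x - inner ℝ p x' ≤ K * ‖x - x'‖ := by
      rw [← inner_sub_right]
      exact (real_inner_le_norm _ _).trans
        (mul_le_mul_of_nonneg_right (norm_le_of_mem_dualDomain hu hp) (norm_nonneg _))
    have h3 : t' * H p - t * H p ≤ M * |t - t'| := by
      rw [← sub_mul, mul_comm, abs_sub_comm]
      refine (le_abs_self _).trans ?_
      rw [abs_mul]
      exact mul_le_mul_of_nonneg_right (hM p hp) (abs_nonneg _)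
    linarith
  rw [abs_le]
  have h1 := key t t' x x'
  have h2 := key t' t x' x
  rw [abs_sub_comm t', norm_sub_rev x'] at h2
  constructor <;> linarith

theorem exists_lipschitzWith_hopf {d : ℕ} {H : Space d → ℝ} (hH : Continuous H)
    {u : Space d → ℝ} {K : ℝ≥0} (hu : LipschitzWith K u) (hconc : ConcaveOn ℝ univ u) :
    ∃ L : ℝ≥0, LipschitzWith L (fun z : ℝ × Space d => hopf H u z.1 z.2) := by
  obtain ⟨M, hM⟩ := exists_abs_le_on_dualDomain hH hu
  refine ⟨M + K, LipschitzWith.of_dist_le_mul fun z z' => ?_⟩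
  have h := hopf_sub_le hH hu hconc hM z.1 z'.1 z.2 z'.2
  have h1 : |z.1 - z'.1| ≤ dist z z' := by
    rw [← Real.dist_eq, Prod.dist_eq]; exact le_max_left _ _
  have h2 : ‖z.2 - z'.2‖ ≤ dist z z' := by
    rw [← dist_eq_norm, Prod.dist_eq]; exact le_max_right _ _
  rw [Real.dist_eq]
  have h3 := mul_le_mul_of_nonneg_left h1 M.2
  have h4 := mul_le_mul_of_nonneg_left h2 K.2
  simp only [NNReal.val_eq_coe] at h3 h4
  push_cast
  linarith

/-- The Hopf formula is jointly concave in `(t, x)`, being an infimum of affine functions. -/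
theorem hopf_concave {d : ℕ} {H : Space d → ℝ} (hH : Continuous H) {u : Space d → ℝ}
    {K : ℝ≥0} (hu : LipschitzWith K u) (hconc : ConcaveOn ℝ univ u) (t t' : ℝ) (x x' : Space d)
    {s : ℝ} (hs0 : 0 ≤ s) (hs1 : s ≤ 1) :
    (1 - s) * hopf H u t x + s * hopf H u t' x' ≤
      hopf H u (t + s * (t' - t)) (x + s • (x' - x)) := by
  obtain ⟨p, hp, h⟩ := exists_hopf_eq hH hu hconc (t + s * (t' - t)) (x + s • (x' - x))
  have h1 := mul_le_mul_of_nonneg_left (hopf_le hH hu hconc t x hp) (sub_nonneg.2 hs1)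
  have h2 := mul_le_mul_of_nonneg_left (hopf_le hH hu hconc t' x' hp) hs0
  rw [h, inner_add_right, inner_smul_right, inner_sub_right]
  linarith

/-! ### The Hopf formula is a viscosity solution -/

theorem partialTime_eq_and_inner_partialSpace_eq {d : ℕ} {φ : ℝ → Space d → ℝ} {t : ℝ}
    {x : Space d} {D : ℝ × Space d →L[ℝ] ℝ}
    (hf : HasFDerivAt (fun z : ℝ × Space d => φ z.1 z.2) D (t, x)) :
    partialTime φ t x = D (1, 0) ∧ ∀ v, inner ℝ (partialSpace φ t x) v = D (0, v) := by
  constructor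
  · have h1 : HasDerivAt (fun τ : ℝ => ((τ, x) : ℝ × Space d)) (1, 0) t :=
      (hasDerivAt_id t).prodMk (hasDerivAt_const t x)
    exact (hf.comp_hasDerivAt t h1).deriv
  · intro v
    have h1 : HasFDerivAt (fun y : Space d => ((t, y) : ℝ × Space d))
        (ContinuousLinearMap.inr ℝ ℝ (Space d)) x :=
      (hasFDerivAt_const t x).prodMk (hasFDerivAt_id x)
    have h3 : fderiv ℝ (φ t) x = D.comp (ContinuousLinearMap.inr ℝ ℝ (Space d)) :=
      (HasFDerivAt.comp x hf h1).fderiv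
    rw [partialSpace, gradient, InnerProductSpace.toDual_symm_apply, h3]
    simp

theorem hasDerivAt_along_line {d : ℕ} {φ : ℝ → Space d → ℝ} {t : ℝ} {x : Space d}
    (hφ : DifferentiableAt ℝ (fun z : ℝ × Space d => φ z.1 z.2) (t, x)) (τ : ℝ) (v : Space d) :
    HasDerivAt (fun s : ℝ => φ (t + s * τ) (x + s • v))
      (partialTime φ t x * τ + inner ℝ (partialSpace φ t x) v) 0 := by
  set D := fderiv ℝ (fun z : ℝ × Space d => φ z.1 z.2) (t, x) with hD
  have hf : HasFDerivAt (fun z : ℝ × Space d => φ z.1 z.2) D (t, x) := hφ.hasFDerivAt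
  obtain ⟨ht, hx⟩ := partialTime_eq_and_inner_partialSpace_eq hf
  have hline : HasDerivAt (fun s : ℝ => ((t + s * τ, x + s • v) : ℝ × Space d)) (τ, v) 0 := by
    have h1 : HasDerivAt (fun s : ℝ => t + s * τ) τ 0 := by
      simpa using ((hasDerivAt_id (0 : ℝ)).mul_const τ).const_add t
    have h2 : HasDerivAt (fun s : ℝ => x + s • v) v 0 := by
      simpa using ((hasDerivAt_id (0 : ℝ)).smul_const v).const_add x
    exact h1.prodMk h2
  have hf' : HasFDerivAt (fun z : ℝ × Space d => φ z.1 z.2) D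
      ((fun s : ℝ => ((t + s * τ, x + s • v) : ℝ × Space d)) 0) := by simpa using hf
  have h := hf'.comp_hasDerivAt (0 : ℝ) hline
  have e : D (τ, v) = partialTime φ t x * τ + inner ℝ (partialSpace φ t x) v := by
    rw [ht, hx, show ((τ, v) : ℝ × Space d) = τ • (1, 0) + (0, v) by simp, map_add, map_smul,
      smul_eq_mul, mul_comm]
  rw [← e]
  exact h

theorem tendsto_line {d : ℕ} (t τ : ℝ) (x v : Space d) :
    Tendsto (fun s : ℝ => ((t + s * τ, x + s • v) : ℝ × Space d)) (𝓝 0) (𝓝 (t, x)) := by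
  have : Continuous (fun s : ℝ => ((t + s * τ, x + s • v) : ℝ × Space d)) := by fun_prop
  simpa using this.tendsto 0

/-- A one-sided affine minorant at `0` bounds the derivative there from below. -/
theorem le_of_hasDerivAt_of_le {f : ℝ → ℝ} {f' c : ℝ} (hf : HasDerivAt f f' 0)
    (h : ∀ᶠ s in 𝓝[>] (0 : ℝ), f 0 + s * c ≤ f s) : c ≤ f' := by
  have h1 := (hasDerivAt_iff_tendsto_slope.1 hf).mono_left
    (nhdsWithin_mono (0 : ℝ) (fun s (hs : s ∈ Ioi (0:ℝ)) => hs.ne'))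
  refine ge_of_tendsto h1 ?_
  filter_upwards [h, self_mem_nhdsWithin] with s hs hs0
  rw [slope_def_field, sub_zero, le_div_iff₀ hs0]
  linarith

/-- The supersolution property holds for every minimum of affine solutions; the subsolution
property uses that all affine majorants of `u` take part in the minimum. -/
theorem hopf_isViscositySolution {d : ℕ} {H : Space d → ℝ} (hH : Continuous H)
    {u : Space d → ℝ} {K : ℝ≥0} (hu : LipschitzWith K u) (hconc : ConcaveOn ℝ univ u) :
    IsViscositySolution (fun _ _ p => H p) (hopf H u) where
  continuousOn := (exists_lipschitzWith_hopf hH hu hconc).choose_spec.continuous.continuousOn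
  subsolution := by
    intro φ hφ t x ht heq hle
    have hd : DifferentiableAt ℝ (fun z : ℝ × Space d => φ z.1 z.2) (t, x) :=
      hφ.differentiable (by simp) _
    set a := partialTime φ t x
    set p := partialSpace φ t x
    -- concavity turns the local contact into a global affine majorant, read off at time `0`
    have hglob : ∀ y, u y ≤ hopf H u t x - a * t + inner ℝ p (y - x) := by
      intro y
      have h1 := hasDerivAt_along_line hd (0 - t) (y - x)
      have h2 := le_of_hasDerivAt_of_le (c := u y - hopf H u t x) h1 ?_
      · linarith
      · have h3 := (tendsto_line t (0 - t) x (y - x)).eventually hle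
        filter_upwards [nhdsWithin_le_nhds h3, Ioo_mem_nhdsGT (zero_lt_one' ℝ)] with s hs hs01
        have h4 := hopf_concave hH hu hconc t 0 x y hs01.1.le hs01.2.le
        rw [hopf_zero hH hu hconc] at h4
        simp only [zero_mul, add_zero, zero_smul, heq]
        linarith
    have hc : ∀ y, inner ℝ p x + a * t - hopf H u t x ≤ inner ℝ p y - u y := by
      intro y
      have := hglob y
      rw [inner_sub_right] at this
      linarith
    have h1 := hopf_le hH hu hconc t x (mem_dualDomain_of_forall_le hc)
    have h2 := le_concaveDual hc
    have h3 : t * (a + H p) ≤ 0 := by linarith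
    exact nonpos_of_mul_nonpos_right h3 ht
  supersolution := by
    intro φ hφ t x ht heq hle
    have hd : DifferentiableAt ℝ (fun z : ℝ × Space d => φ z.1 z.2) (t, x) :=
      hφ.differentiable (by simp) _
    set a := partialTime φ t x
    set p := partialSpace φ t x
    obtain ⟨q, hq, hqe⟩ := exists_hopf_eq hH hu hconc t x
    -- `φ` touches the affine solution of momentum `q` from below, so their derivatives agree
    have key : ∀ (τ : ℝ) (v : Space d), a * τ + inner ℝ p v ≤ inner ℝ q v - τ * H q := by
      intro τ v
      have h1 := (hasDerivAt_along_line hd τ v).neg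
      have h2 := le_of_hasDerivAt_of_le (c := -(inner ℝ q v - τ * H q)) h1 ?_
      · linarith
      · filter_upwards [nhdsWithin_le_nhds ((tendsto_line t τ x v).eventually hle)] with s hs
        have h3 := hopf_le hH hu hconc (t + s * τ) (x + s • v) hq
        rw [inner_add_right, inner_smul_right] at h3
        simp only [Pi.neg_apply, zero_mul, add_zero, zero_smul, heq]
        linarith
    have hpq : p = q := by
      have h1 := key 0 (p - q)
      have h2 : inner ℝ (p - q) (p - q) ≤ (0 : ℝ) := by
        rw [inner_sub_left]; linarith
      exact sub_eq_zero.1 (inner_self_eq_zero.1 (le_antisymm h2 real_inner_self_nonneg))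
    have h1 := key (-1) 0
    simp only [inner_zero_right] at h1
    rw [hpq]
    linarith

theorem hopf_isCauchyViscositySolution {d : ℕ} {H : Space d → ℝ} (hH : Continuous H)
    {u : Space d → ℝ} {K : ℝ≥0} (hu : LipschitzWith K u) (hconc : ConcaveOn ℝ univ u) :
    IsCauchyViscositySolution (fun _ _ p => H p) u (hopf H u) where
  viscosity := hopf_isViscositySolution hH hu hconc
  initial := hopf_zero hH hu hconc
  bounded := by
    intro T _
    obtain ⟨M, hM⟩ := exists_abs_le_on_dualDomain hH hu
    refine ⟨M * T, fun t ht x => ?_⟩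
    have h := hopf_sub_le hH hu hconc hM t 0 x x
    rw [hopf_zero hH hu hconc, sub_self, norm_zero, sub_zero, mul_zero, add_zero,
      abs_of_pos ht.1] at h
    exact h.trans (mul_le_mul_of_nonneg_left ht.2.le M.2)
  lipschitz := by
    intro T _
    obtain ⟨L, hL⟩ := exists_lipschitzWith_hopf hH hu hconc
    exact ⟨L + K * 1, (hL.sub (hu.comp LipschitzWith.prod_snd)).lipschitzOnWith⟩

/-! ### Second-order contact and the comparison principle -/

/-- `(a, p)` is a superdifferential of `w` at `(t, x)` with a quadratic error: a paraboloid with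
derivative `(a, p)` at `(t, x)` touches `w` there locally from above. -/
def HasSuperjet {d : ℕ} (w : ℝ → Space d → ℝ) (t : ℝ) (x : Space d) (a : ℝ) (p : Space d) :
    Prop :=
  ∃ M : ℝ, ∀ᶠ z : ℝ × Space d in 𝓝 (t, x),
    w z.1 z.2 ≤ w t x + a * (z.1 - t) + inner ℝ p (z.2 - x) + M * ((z.1 - t) ^ 2 + ‖z.2 - x‖ ^ 2)

/-- `(a, p)` is a subdifferential of `w` at `(t, x)` with a quadratic error: a paraboloid with
derivative `(a, p)` at `(t, x)` touches `w` there locally from below. -/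
def HasSubjet {d : ℕ} (w : ℝ → Space d → ℝ) (t : ℝ) (x : Space d) (a : ℝ) (p : Space d) :
    Prop :=
  ∃ M : ℝ, ∀ᶠ z : ℝ × Space d in 𝓝 (t, x),
    w t x + a * (z.1 - t) + inner ℝ p (z.2 - x) - M * ((z.1 - t) ^ 2 + ‖z.2 - x‖ ^ 2) ≤ w z.1 z.2

theorem contDiff_paraboloid {d : ℕ} (c t a M : ℝ) (x p : Space d) :
    ContDiff ℝ ∞ (fun z : ℝ × Space d =>
      c + a * (z.1 - t) + inner ℝ p (z.2 - x) + M * ((z.1 - t) ^ 2 + ‖z.2 - x‖ ^ 2)) := by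
  have h1 : ContDiff ℝ ∞ (fun z : ℝ × Space d => z.1 - t) := contDiff_fst.sub contDiff_const
  have h2 : ContDiff ℝ ∞ (fun z : ℝ × Space d => z.2 - x) := contDiff_snd.sub contDiff_const
  exact ((contDiff_const.add (contDiff_const.mul h1)).add (contDiff_const.inner ℝ h2)).add
    (contDiff_const.mul ((h1.pow 2).add (h2.norm_sq ℝ)))

theorem partial_paraboloid {d : ℕ} (c t a M : ℝ) (x p : Space d) :
    partialTime (fun r y => c + a * (r - t) + inner ℝ p (y - x) + M * ((r - t) ^ 2 + ‖y - x‖ ^ 2))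
      t x = a ∧
    partialSpace (fun r y => c + a * (r - t) + inner ℝ p (y - x)
      + M * ((r - t) ^ 2 + ‖y - x‖ ^ 2)) t x = p := by
  set φ : ℝ → Space d → ℝ := fun r y =>
    c + a * (r - t) + inner ℝ p (y - x) + M * ((r - t) ^ 2 + ‖y - x‖ ^ 2) with hφ
  have hd : DifferentiableAt ℝ (fun z : ℝ × Space d => φ z.1 z.2) (t, x) :=
    (contDiff_paraboloid c t a M x p).differentiable (by simp) _
  have key : ∀ (τ : ℝ) (v : Space d),
      partialTime φ t x * τ + inner ℝ (partialSpace φ t x) v = a * τ + inner ℝ p v := by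
    intro τ v
    refine (hasDerivAt_along_line hd τ v).unique ?_
    have e : (fun s : ℝ => φ (t + s * τ) (x + s • v)) =
        fun s => c + (a * τ + inner ℝ p v) * s + M * (τ ^ 2 + ‖v‖ ^ 2) * s ^ 2 := by
      funext s
      simp only [hφ, add_sub_cancel_left, inner_smul_right, norm_smul, mul_pow, Real.norm_eq_abs,
        sq_abs]
      ring
    rw [e]
    have h1 : HasDerivAt (fun s : ℝ => c + (a * τ + inner ℝ p v) * s
        + M * (τ ^ 2 + ‖v‖ ^ 2) * s ^ 2) (0 + (a * τ + inner ℝ p v) * 1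
        + M * (τ ^ 2 + ‖v‖ ^ 2) * (((2 : ℕ) : ℝ) * (0 : ℝ) ^ (2 - 1))) 0 :=
      ((hasDerivAt_const _ _).add ((hasDerivAt_id (0 : ℝ)).const_mul _)).add
        ((hasDerivAt_pow 2 (0 : ℝ)).const_mul _)
    simpa using h1
  constructor
  · simpa using key 1 0
  · refine ext_inner_right ℝ fun v => ?_
    simpa using key 0 v

theorem IsViscositySolution.add_le_zero_of_hasSuperjet {d : ℕ} {H : ℝ → Space d → Space d → ℝ}
    {w : ℝ → Space d → ℝ} (hw : IsViscositySolution H w) {t a : ℝ} {x p : Space d} (ht : 0 < t)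
    (h : HasSuperjet w t x a p) : a + H t x p ≤ 0 := by
  obtain ⟨M, hM⟩ := h
  have h1 := hw.subsolution (fun r y => w t x + a * (r - t) + inner ℝ p (y - x)
    + M * ((r - t) ^ 2 + ‖y - x‖ ^ 2)) (contDiff_paraboloid (w t x) t a M x p) t x ht (by simp) hM
  rwa [(partial_paraboloid (w t x) t a M x p).1, (partial_paraboloid (w t x) t a M x p).2] at h1

theorem IsViscositySolution.zero_le_add_of_hasSubjet {d : ℕ} {H : ℝ → Space d → Space d → ℝ}
    {w : ℝ → Space d → ℝ} (hw : IsViscositySolution H w) {t a : ℝ} {x p : Space d} (ht : 0 < t)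
    (h : HasSubjet w t x a p) : 0 ≤ a + H t x p := by
  obtain ⟨M, hM⟩ := h
  have h1 := hw.supersolution (fun r y => w t x + a * (r - t) + inner ℝ p (y - x)
    + -M * ((r - t) ^ 2 + ‖y - x‖ ^ 2)) (contDiff_paraboloid (w t x) t a (-M) x p) t x ht (by simp) (by
    filter_upwards [hM] with z hz
    linarith)
  rwa [(partial_paraboloid (w t x) t a (-M) x p).1,
    (partial_paraboloid (w t x) t a (-M) x p).2] at h1

/-- The part of the doubling of variables that takes place at a maximum point `(s, y, t, x)` of
the penalized difference: the two jets there are incompatible as soon as the slope `η` of the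
time penalty dominates the oscillation of `H` caused by the space penalty `δ ‖x‖²`. -/
theorem false_of_doubling_max {d : ℕ} {H : Space d → ℝ} {w₁ w₂ : ℝ → Space d → ℝ}
    (h₁ : ∀ t x a p, 0 < t → HasSuperjet w₁ t x a p → a + H p ≤ 0)
    (h₂ : ∀ t x a p, 0 < t → HasSubjet w₂ t x a p → 0 ≤ a + H p)
    {N δ B l T s t : ℝ} {x y : Space d} (hB : 0 ≤ B) (hl : 0 < l) (hs : 0 < s) (ht : 0 < t)
    (htT : t < T)
    (hmax : ∀ᶠ z : (ℝ × Space d) × (ℝ × Space d) in 𝓝 ((s, y), (t, x)),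
      w₁ z.1.1 z.1.2 - w₂ z.2.1 z.2.2 - N * ‖z.1.2 - z.2.2‖ ^ 2 - N * (z.1.1 - z.2.1) ^ 2
        - δ * ‖z.2.2‖ ^ 2 - B * Real.exp (l * (z.2.1 - T)) ≤
      w₁ s y - w₂ t x - N * ‖y - x‖ ^ 2 - N * (s - t) ^ 2
        - δ * ‖x‖ ^ 2 - B * Real.exp (l * (t - T)))
    (hosc : H ((2 * N) • (y - x) - (2 * δ) • x) - H ((2 * N) • (y - x)) <
      B * l * Real.exp (l * (t - T))) : False := by
  have hsup : HasSuperjet w₁ s y (2 * N * (s - t)) ((2 * N) • (y - x)) := by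
    refine ⟨N, ?_⟩
    have hc : Tendsto (fun z : ℝ × Space d => (z, ((t, x) : ℝ × Space d))) (𝓝 (s, y))
        (𝓝 ((s, y), (t, x))) := (by fun_prop : Continuous _).tendsto (s, y)
    filter_upwards [hc.eventually hmax] with z hz
    have e1 : ‖z.2 - x‖ ^ 2 = ‖z.2 - y‖ ^ 2 + 2 * inner ℝ (y - x) (z.2 - y) + ‖y - x‖ ^ 2 := by
      rw [show z.2 - x = (z.2 - y) + (y - x) by abel, norm_add_sq_real, real_inner_comm]
    rw [e1] at hz
    rw [inner_smul_left]
    simp only [conj_trivial]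
    linarith
  have hsub : HasSubjet w₂ t x (2 * N * (s - t) - B * l * Real.exp (l * (t - T)))
      ((2 * N) • (y - x) - (2 * δ) • x) := by
    refine ⟨|N| + |δ| + B * l ^ 2, ?_⟩
    have hc : Tendsto (fun z : ℝ × Space d => (((s, y) : ℝ × Space d), z)) (𝓝 (t, x))
        (𝓝 ((s, y), (t, x))) := (by fun_prop : Continuous _).tendsto (t, x)
    have hsmall : ∀ᶠ z : ℝ × Space d in 𝓝 (t, x), |l * (z.1 - t)| < 1 := by
      have : Continuous (fun z : ℝ × Space d => |l * (z.1 - t)|) := by fun_prop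
      exact (this.tendsto (t, x)).eventually_lt_const (by simp)
    filter_upwards [hc.eventually hmax, hsmall] with z hz hz1
    have e1 : ‖y - z.2‖ ^ 2 = ‖z.2 - x‖ ^ 2 - 2 * inner ℝ (y - x) (z.2 - x) + ‖y - x‖ ^ 2 := by
      rw [show y - z.2 = (y - x) - (z.2 - x) by abel, norm_sub_sq_real]; ring
    have e2 : ‖z.2‖ ^ 2 = ‖z.2 - x‖ ^ 2 + 2 * inner ℝ x (z.2 - x) + ‖x‖ ^ 2 := by
      conv_lhs => rw [show z.2 = x + (z.2 - x) by abel, norm_add_sq_real]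
      ring
    have e3 : Real.exp (l * (z.1 - T)) ≤ Real.exp (l * (t - T))
        + l * Real.exp (l * (t - T)) * (z.1 - t) + l ^ 2 * (z.1 - t) ^ 2 := by
      have h1 := (abs_le.1 (Real.abs_exp_sub_one_sub_id_le hz1.le)).2
      have h2 : Real.exp (l * (z.1 - T)) = Real.exp (l * (t - T)) * Real.exp (l * (z.1 - t)) := by
        rw [← Real.exp_add]; ring_nf
      have h3 : Real.exp (l * (t - T)) ≤ 1 := Real.exp_le_one_iff.2 (by nlinarith)
      have h4 := Real.exp_pos (l * (t - T))
      have h5 : 0 ≤ (l * (z.1 - t)) ^ 2 := sq_nonneg _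
      rw [h2]
      nlinarith
    have e4 := mul_le_mul_of_nonneg_left e3 hB
    have e5 : N * ((z.1 - t) ^ 2 + ‖z.2 - x‖ ^ 2) ≤ |N| * ((z.1 - t) ^ 2 + ‖z.2 - x‖ ^ 2) :=
      mul_le_mul_of_nonneg_right (le_abs_self N) (by positivity)
    have e6 : δ * ‖z.2 - x‖ ^ 2 ≤ |δ| * ((z.1 - t) ^ 2 + ‖z.2 - x‖ ^ 2) := by
      have := mul_le_mul_of_nonneg_right (le_abs_self δ) (sq_nonneg ‖z.2 - x‖)
      have h' : 0 ≤ |δ| * (z.1 - t) ^ 2 := by positivity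
      linarith
    have e7 : 0 ≤ B * l ^ 2 * ‖z.2 - x‖ ^ 2 := by positivity
    rw [e1, e2] at hz
    rw [inner_sub_left, inner_smul_left, inner_smul_left]
    simp only [conj_trivial]
    linarith
  have g1 := h₁ _ _ _ _ hs hsup
  have g2 := h₂ _ _ _ _ ht hsub
  linarith

/-- Choice of the coupling constant in the doubling of variables: the penalty `N m²` can be paid
for by an `L`-Lipschitz function only at small distances `m`. -/
theorem exists_coupling {L σ : ℝ} (hL0 : 0 ≤ L) (hσ : 0 < σ) :
    ∃ N : ℝ, 1 ≤ N ∧ ∀ m : ℝ, 0 ≤ m → N * m ^ 2 ≤ L * m →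
      N * m ≤ L ∧ m < 1 ∧ L * m < σ ∧ L * m ≤ 1 := by
  refine ⟨1 + 2 * L + L ^ 2 + L ^ 2 / σ, by nlinarith [sq_nonneg L, div_nonneg (sq_nonneg L) hσ.le],
    fun m hm h => ?_⟩
  have hdiv : 0 ≤ L ^ 2 / σ := by positivity
  rcases hm.eq_or_lt with rfl | hm
  · simp only [mul_zero]; exact ⟨hL0, zero_lt_one, hσ, zero_le_one⟩
  · have h1 : (1 + 2 * L + L ^ 2 + L ^ 2 / σ) * m ≤ L := by
      refine le_of_mul_le_mul_right ?_ hm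
      linarith [h]
    refine ⟨h1, ?_, ?_, ?_⟩
    · by_contra! hm1
      nlinarith [mul_nonneg hdiv hm.le, mul_nonneg (sq_nonneg L) hm.le]
    · by_contra! hm1
      have e : L ^ 2 / σ * σ = L ^ 2 := by field_simp
      have h2 : L * ((1 + 2 * L + L ^ 2 + L ^ 2 / σ) * m) ≤ L * L :=
        mul_le_mul_of_nonneg_left h1 hL0
      have h3 : (1 + L ^ 2 / σ) * σ ≤ (1 + L ^ 2 / σ) * (L * m) :=
        mul_le_mul_of_nonneg_left hm1 (by positivity)
      have h4 : 0 ≤ (2 * L + L ^ 2) * (L * m) := by positivity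
      nlinarith
    · by_contra! hm1
      have h2 : L * ((1 + 2 * L + L ^ 2 + L ^ 2 / σ) * m) ≤ L * L :=
        mul_le_mul_of_nonneg_left h1 hL0
      have h3 : (1 + L ^ 2) * 1 ≤ (1 + L ^ 2) * (L * m) :=
        mul_le_mul_of_nonneg_left hm1.le (by positivity)
      have h4 : 0 ≤ (2 * L + L ^ 2 / σ) * (L * m) := by positivity
      nlinarith

theorem exists_oscillation_radius {d : ℕ} {H : Space d → ℝ} (hH : Continuous H) (r : ℝ) {η : ℝ}
    (hη : 0 < η) :
    ∃ ρ : ℝ, 0 < ρ ∧ ∀ p q : Space d, ‖p‖ ≤ r → ‖q - p‖ < ρ → H q - H p < η := by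
  have huc := (isCompact_closedBall (0 : Space d) (r + 1)).uniformContinuousOn_of_continuous
    hH.continuousOn
  obtain ⟨ρ, hρ0, hρ⟩ := Metric.uniformContinuousOn_iff.1 huc η hη
  refine ⟨min ρ 1, by positivity, fun p q hp hq => ?_⟩
  have h1 : ‖q‖ ≤ ‖p‖ + ‖q - p‖ := by
    simpa using norm_add_le p (q - p)
  have h2 : ‖q - p‖ < 1 := hq.trans_le (min_le_right _ _)
  have h3 := hρ q (by simp; linarith) p (by simp; linarith)
    (by rw [dist_eq_norm]; exact hq.trans_le (min_le_left _ _))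
  rw [Real.dist_eq] at h3
  exact (le_abs_self _).trans_lt h3

set_option maxHeartbeats 1000000 in
/-- Comparison principle: a subsolution that lies below a supersolution at time `0` stays below,
for functions that are Lipschitz on bounded time intervals. Only jets of quadratic type enter. -/
theorem le_of_superjet_of_subjet {d : ℕ} {H : Space d → ℝ} (hH : Continuous H)
    {w₁ w₂ : ℝ → Space d → ℝ}
    (h₁ : ∀ t x a p, 0 < t → HasSuperjet w₁ t x a p → a + H p ≤ 0)
    (h₂ : ∀ t x a p, 0 < t → HasSubjet w₂ t x a p → 0 ≤ a + H p)
    (h0 : ∀ x, w₁ 0 x ≤ w₂ 0 x)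
    (hL₁ : ∀ T : ℝ, 0 < T → ∃ L : ℝ≥0,
      LipschitzOnWith L (fun z : ℝ × Space d => w₁ z.1 z.2) (Ico 0 T ×ˢ univ))
    (hL₂ : ∀ T : ℝ, 0 < T → ∃ L : ℝ≥0,
      LipschitzOnWith L (fun z : ℝ × Space d => w₂ z.1 z.2) (Ico 0 T ×ˢ univ))
    {t : ℝ} (ht : 0 ≤ t) (x : Space d) : w₁ t x ≤ w₂ t x := by
  by_contra! hcon
  obtain ⟨t₁, ht₁, x₁, hx₁⟩ : ∃ t₁ : ℝ, 0 ≤ t₁ ∧ ∃ x₁, w₂ t₁ x₁ < w₁ t₁ x₁ := ⟨t, ht, x, hcon⟩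
  clear hcon ht x t
  obtain ⟨σ, hσ, hσ3⟩ : ∃ σ : ℝ, 0 < σ ∧ w₁ t₁ x₁ - w₂ t₁ x₁ = 3 * σ :=
    ⟨(w₁ t₁ x₁ - w₂ t₁ x₁) / 3, by linarith, by ring⟩
  set T := t₁ + 1 with hT
  obtain ⟨L₁, hL₁⟩ := hL₁ (T + 2) (by linarith)
  obtain ⟨L₂, hL₂⟩ := hL₂ (T + 2) (by linarith)
  obtain ⟨L, hL0, hw₁, hw₂⟩ : ∃ L : ℝ, 0 ≤ L ∧
      (∀ s t x y, 0 ≤ s → s ≤ T + 1 → 0 ≤ t → t ≤ T + 1 →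
        w₁ s y - w₁ t x ≤ L * max |s - t| ‖y - x‖) ∧
      (∀ s t x y, 0 ≤ s → s ≤ T + 1 → 0 ≤ t → t ≤ T + 1 →
        w₂ s y - w₂ t x ≤ L * max |s - t| ‖y - x‖) := by
    refine ⟨max L₁ L₂, by positivity, ?_, ?_⟩
    · intro s t x y hs hs' ht ht'
      have h := hL₁.dist_le_mul (s, y) ⟨⟨hs, by linarith⟩, trivial⟩ (t, x)
        ⟨⟨ht, by linarith⟩, trivial⟩
      rw [Real.dist_eq, Prod.dist_eq, Real.dist_eq, dist_eq_norm] at h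
      exact (le_abs_self _).trans (h.trans
        (mul_le_mul_of_nonneg_right (le_max_left _ _) (by positivity)))
    · intro s t x y hs hs' ht ht'
      have h := hL₂.dist_le_mul (s, y) ⟨⟨hs, by linarith⟩, trivial⟩ (t, x)
        ⟨⟨ht, by linarith⟩, trivial⟩
      rw [Real.dist_eq, Prod.dist_eq, Real.dist_eq, dist_eq_norm] at h
      exact (le_abs_self _).trans (h.trans
        (mul_le_mul_of_nonneg_right (le_max_right _ _) (by positivity)))
  -- an a priori bound for the difference at two points
  set C : ℝ := L * (2 * T + 1) with hC
  have hC0 : 0 ≤ C := by have : 0 ≤ 2 * T + 1 := by linarith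
                         positivity
  have hbound : ∀ s t x y, 0 ≤ s → s ≤ T + 1 → 0 ≤ t → t ≤ T →
      w₁ s y - w₂ t x ≤ C + L * ‖y - x‖ := by
    intro s t x y hs hs' ht ht'
    have g1 := hw₁ s 0 y y hs hs' le_rfl (by linarith)
    have g2 := hw₂ 0 t x x le_rfl (by linarith) ht (by linarith)
    have g3 := hw₁ 0 0 x y le_rfl (by linarith) le_rfl (by linarith)
    rw [sub_self, norm_zero, sub_zero, max_eq_left (abs_nonneg _), abs_of_nonneg hs] at g1
    rw [sub_self, norm_zero, zero_sub, abs_neg, max_eq_left (abs_nonneg _), abs_of_nonneg ht] at g2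
    rw [sub_self, abs_zero, max_eq_right (norm_nonneg _)] at g3
    have g4 := mul_le_mul_of_nonneg_left hs' hL0
    have g5 := mul_le_mul_of_nonneg_left ht' hL0
    have g6 := h0 x
    linarith
  -- the time penalty `B exp (l (t - T))` is below `σ` at `t₁` and exceeds `C` at `T`
  set B : ℝ := C + 1 with hB
  have hB0 : 0 < B := by linarith
  set l : ℝ := B / σ with hl
  have hl0 : 0 < l := by positivity
  have hθ₁ : B * Real.exp (l * (t₁ - T)) ≤ σ := by
    have e : l * (t₁ - T) = -l := by rw [hT]; ring
    rw [e, Real.exp_neg, ← div_eq_mul_inv, div_le_iff₀ (Real.exp_pos l)]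
    have h1 := Real.add_one_le_exp l
    have h2 : σ * l = B := by rw [hl]; field_simp
    nlinarith
  set η : ℝ := B * l * Real.exp (-(l * T)) with hη
  have hη0 : 0 < η := by positivity
  -- uniform continuity of `H` on the relevant momenta fixes the space penalty
  obtain ⟨ρ, hρ0, hρ⟩ := exists_oscillation_radius hH (2 * L) hη0
  obtain ⟨δ, hδ0, hδρ, hδσ⟩ : ∃ δ : ℝ, 0 < δ ∧ 4 * δ * (C + 1) < ρ ^ 2 ∧ δ * ‖x₁‖ ^ 2 ≤ σ := by
    have g1 : 0 < ρ ^ 2 / (8 * (C + 1)) := by positivity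
    have g2 : 0 < σ / (1 + ‖x₁‖ ^ 2) := by positivity
    refine ⟨min (ρ ^ 2 / (8 * (C + 1))) (σ / (1 + ‖x₁‖ ^ 2)), lt_min g1 g2, ?_, ?_⟩
    · have h1 : min (ρ ^ 2 / (8 * (C + 1))) (σ / (1 + ‖x₁‖ ^ 2)) * (8 * (C + 1)) ≤ ρ ^ 2 :=
        (le_div_iff₀ (by positivity)).1 (min_le_left _ _)
      have h2 : 0 < ρ ^ 2 := by positivity
      linarith
    · have h1 : min (ρ ^ 2 / (8 * (C + 1))) (σ / (1 + ‖x₁‖ ^ 2)) * (1 + ‖x₁‖ ^ 2) ≤ σ :=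
        (le_div_iff₀ (by positivity)).1 (min_le_right _ _)
      have h2 := (lt_min g1 g2).le
      linarith
  -- the coupling constant `N` forces the two points to be `m`-close with `L m < min σ 1`, `m < 1`
  obtain ⟨N, hN1, hN⟩ := exists_coupling hL0 hσ
  -- the penalized difference and its maximum
  set Φ : (ℝ × Space d) × (ℝ × Space d) → ℝ := fun z =>
    w₁ z.1.1 z.1.2 - w₂ z.2.1 z.2.2 - N * ‖z.1.2 - z.2.2‖ ^ 2 - N * (z.1.1 - z.2.1) ^ 2
      - δ * ‖z.2.2‖ ^ 2 - B * Real.exp (l * (z.2.1 - T)) with hΦ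
  set a₀ : ℝ := 1 + L + C with ha₀
  set R : ℝ := (C + L * a₀) / δ + 2 + a₀ + ‖x₁‖ with hR
  have hconf : ∀ s t x y, 0 ≤ s → s ≤ T + 1 → 0 ≤ t → t ≤ T → 0 ≤ Φ ((s, y), (t, x)) →
      ‖x‖ < R ∧ ‖y‖ < R := by
    intro s t x y hs hs' ht ht' hpos
    have g1 := hbound s t x y hs hs' ht ht'
    simp only [hΦ] at hpos
    have g2 : 0 ≤ N * (s - t) ^ 2 := by positivity
    have g3 : 0 ≤ B * Real.exp (l * (t - T)) := by positivity
    have g4 : 0 ≤ δ * ‖x‖ ^ 2 := by positivity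
    have hn := norm_nonneg (y - x)
    have hm : ‖y - x‖ ≤ a₀ := by
      by_contra! hlt
      have i1 : ‖y - x‖ ^ 2 ≤ N * ‖y - x‖ ^ 2 := le_mul_of_one_le_left (sq_nonneg _) hN1
      have i2 : ‖y - x‖ ^ 2 ≤ C + L * ‖y - x‖ := by linarith
      nlinarith
    have g5 : 0 ≤ N * ‖y - x‖ ^ 2 := by positivity
    have g6 : δ * ‖x‖ ^ 2 ≤ C + L * a₀ := by
      have := mul_le_mul_of_nonneg_left hm hL0
      linarith
    have g7 : ‖x‖ ≤ (C + L * a₀) / δ + 1 := by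
      have : ‖x‖ ^ 2 ≤ (C + L * a₀) / δ := by rw [le_div_iff₀ hδ0]; linarith
      nlinarith [sq_nonneg (‖x‖ - 1)]
    have g8 : ‖y‖ ≤ ‖x‖ + ‖y - x‖ := by simpa using norm_add_le x (y - x)
    have g9 := norm_nonneg x₁
    have : 0 ≤ a₀ := by positivity
    constructor <;> linarith
  set S : Set ((ℝ × Space d) × (ℝ × Space d)) :=
    (Icc 0 (T + 1) ×ˢ Metric.closedBall 0 R) ×ˢ (Icc 0 T ×ˢ Metric.closedBall 0 R) with hS
  have hScomp : IsCompact S :=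
    (isCompact_Icc.prod (isCompact_closedBall _ _)).prod
      (isCompact_Icc.prod (isCompact_closedBall _ _))
  have hΦc : ContinuousOn Φ S := by
    have c1 : ContinuousOn (fun z : (ℝ × Space d) × (ℝ × Space d) => w₁ z.1.1 z.1.2) S := by
      refine hL₁.continuousOn.comp (f := Prod.fst) continuous_fst.continuousOn fun z hz => ?_
      exact ⟨⟨hz.1.1.1, by linarith [hz.1.1.2]⟩, trivial⟩
    have c2 : ContinuousOn (fun z : (ℝ × Space d) × (ℝ × Space d) => w₂ z.2.1 z.2.2) S := by
      refine hL₂.continuousOn.comp (f := Prod.snd) continuous_snd.continuousOn fun z hz => ?_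
      exact ⟨⟨hz.2.1.1, by linarith [hz.2.1.2]⟩, trivial⟩
    have c3 : Continuous (fun z : (ℝ × Space d) × (ℝ × Space d) => N * ‖z.1.2 - z.2.2‖ ^ 2) := by
      fun_prop
    have c4 : Continuous (fun z : (ℝ × Space d) × (ℝ × Space d) => N * (z.1.1 - z.2.1) ^ 2) := by
      fun_prop
    have c5 : Continuous (fun z : (ℝ × Space d) × (ℝ × Space d) => δ * ‖z.2.2‖ ^ 2) := by fun_prop
    have c6 : Continuous (fun z : (ℝ × Space d) × (ℝ × Space d) =>
      B * Real.exp (l * (z.2.1 - T))) := by fun_prop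
    exact ((((c1.sub c2).sub c3.continuousOn).sub c4.continuousOn).sub c5.continuousOn).sub
      c6.continuousOn
  have hΦ₁ : σ ≤ Φ ((t₁, x₁), (t₁, x₁)) := by
    simp only [hΦ, sub_self, norm_zero]
    nlinarith
  have hmem₁ : ((t₁, x₁), (t₁, x₁)) ∈ S := by
    have := hconf t₁ t₁ x₁ x₁ ht₁ (by linarith) ht₁ (by linarith) (by linarith)
    exact ⟨⟨⟨ht₁, by linarith⟩, by simpa using this.1.le⟩, ⟨ht₁, by linarith⟩, by simpa using this.1.le⟩
  obtain ⟨⟨⟨s, y⟩, ⟨t, x⟩⟩, hzS, hzmax⟩ := hScomp.exists_isMaxOn ⟨_, hmem₁⟩ hΦc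
  obtain ⟨⟨⟨hs0, hs1⟩, -⟩, ⟨ht0, ht2⟩, -⟩ := hzS
  simp only at hs0 hs1 ht0 ht2
  have hval : σ ≤ Φ ((s, y), (t, x)) := hΦ₁.trans (hzmax hmem₁)
  obtain ⟨hxR, hyR⟩ := hconf s t x y hs0 hs1 ht0 ht2 (hσ.le.trans hval)
  -- comparing with the diagonal point `(t, x, t, x)`
  have hdiag : Φ ((t, x), (t, x)) ≤ Φ ((s, y), (t, x)) :=
    hzmax (show ((t, x), (t, x)) ∈ S from
      ⟨⟨⟨ht0, by linarith⟩, by simpa using hxR.le⟩, ⟨ht0, ht2⟩, by simpa using hxR.le⟩)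
  simp only [hΦ, sub_self, norm_zero] at hdiag
  set m : ℝ := max |s - t| ‖y - x‖ with hm
  have hm0 : 0 ≤ m := by positivity
  have hsm : |s - t| ≤ m := le_max_left _ _
  have hym : ‖y - x‖ ≤ m := le_max_right _ _
  have hlip₁ := hw₁ s t x y hs0 hs1 ht0 (by linarith)
  rw [← hm] at hlip₁
  have hNm : N * m ^ 2 ≤ L * m := by
    have hN0 : 0 ≤ N := by linarith
    have i1 : 0 ≤ N * (s - t) ^ 2 := by positivity
    have i2 : 0 ≤ N * ‖y - x‖ ^ 2 := by positivity
    rcases max_choice |s - t| ‖y - x‖ with h | h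
    · rw [show m ^ 2 = (s - t) ^ 2 by rw [hm, h, sq_abs]]
      linarith
    · rw [show m ^ 2 = ‖y - x‖ ^ 2 by rw [hm, h]]
      linarith
  obtain ⟨hNm1, hm1, hLσ, hL1⟩ := hN m hm0 hNm
  have hN0 : 0 < N := by linarith
  have hval' := hval
  simp only [hΦ] at hval'
  have p1 : 0 ≤ N * ‖y - x‖ ^ 2 := by positivity
  have p2 : 0 ≤ N * (s - t) ^ 2 := by positivity
  have p3 : 0 ≤ δ * ‖x‖ ^ 2 := by positivity
  have p4 : 0 < B * Real.exp (l * (t - T)) := by positivity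
  -- the maximum is not on the boundary of the time intervals
  have hs : 0 < s := by
    rcases hs0.eq_or_lt with h | h
    · have i1 := hw₂ s t x y hs0 hs1 ht0 (by linarith)
      rw [← hm] at i1
      have i2 := h0 y
      rw [← h] at i1 hval' p2
      linarith
    · exact h
  have ht : 0 < t := by
    rcases ht0.eq_or_lt with h | h
    · have i2 := h0 x
      rw [← h] at hlip₁ hval' p2 p4
      linarith
    · exact h
  have hbd := hbound s t x y hs0 hs1 ht0 ht2
  have hLy : L * ‖y - x‖ ≤ 1 := (mul_le_mul_of_nonneg_left hym hL0).trans hL1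
  have htT : t < T := by
    refine lt_of_le_of_ne ht2 fun h => ?_
    rw [h, sub_self, mul_zero, Real.exp_zero, mul_one] at hval'
    rw [h] at hbd
    have : 0 ≤ N * (s - T) ^ 2 := by positivity
    linarith
  have hsT : s < T + 1 := by
    have := (abs_lt.1 (hsm.trans_lt hm1)).2
    linarith
  refine false_of_doubling_max (N := N) (δ := δ) (B := B) (l := l) (T := T) h₁ h₂ hB0.le hl0 hs ht
    htT (x := x) (y := y) ?_ ?_
  · have hopen : S ∈ 𝓝 ((s, y), (t, x)) := by
      refine prod_mem_nhds (prod_mem_nhds (Icc_mem_nhds hs hsT) ?_)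
        (prod_mem_nhds (Icc_mem_nhds ht htT) ?_)
      · exact Metric.closedBall_mem_nhds_of_mem (by simpa using hyR)
      · exact Metric.closedBall_mem_nhds_of_mem (by simpa using hxR)
    filter_upwards [hopen] with z hz
    exact hzmax hz
  · have hp : ‖(2 * N) • (y - x)‖ ≤ 2 * L := by
      rw [norm_smul, Real.norm_of_nonneg (by positivity)]
      have := mul_le_mul_of_nonneg_left hym hN0.le
      linarith
    have hq : ‖(2 * N) • (y - x) - (2 * δ) • x - (2 * N) • (y - x)‖ < ρ := by
      rw [show (2 * N) • (y - x) - (2 * δ) • x - (2 * N) • (y - x) = -((2 * δ) • x) by abel,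
        norm_neg, norm_smul, Real.norm_of_nonneg (by positivity)]
      refine lt_of_pow_lt_pow_left₀ 2 hρ0.le ?_
      have i1 : δ * ‖x‖ ^ 2 ≤ C + 1 := by linarith
      have i2 := mul_le_mul_of_nonneg_left i1 (by positivity : 0 ≤ 4 * δ)
      calc (2 * δ * ‖x‖) ^ 2 = 4 * δ * (δ * ‖x‖ ^ 2) := by ring
        _ < ρ ^ 2 := i2.trans_lt hδρ
    refine (hρ _ _ hp hq).trans_le ?_
    rw [hη]
    refine mul_le_mul_of_nonneg_left (Real.exp_le_exp.2 ?_) (by positivity)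
    nlinarith

theorem IsCauchyViscositySolution.exists_lipschitzOnWith {d : ℕ}
    {H : ℝ → Space d → Space d → ℝ} {u : Space d → ℝ} {K : ℝ≥0} (hu : LipschitzWith K u)
    {v : ℝ → Space d → ℝ} (hv : IsCauchyViscositySolution H u v) (T : ℝ) (hT : 0 < T) :
    ∃ L : ℝ≥0, LipschitzOnWith L (fun z : ℝ × Space d => v z.1 z.2) (Ico 0 T ×ˢ univ) := by
  obtain ⟨L, hL⟩ := hv.lipschitz T hT
  have h1 : LipschitzOnWith (L + K * 1) (fun z : ℝ × Space d => v z.1 z.2) (Ioo 0 T ×ˢ univ) := by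
    have := hL.add (hu.comp LipschitzWith.prod_snd).lipschitzOnWith
    simpa using this
  have hcl : closure (Ioo 0 T ×ˢ (univ : Set (Space d))) = Icc 0 T ×ˢ univ := by
    rw [closure_prod_eq, closure_Ioo hT.ne, closure_univ]
  refine ⟨_, (h1.closure ?_).mono ?_⟩
  · rw [hcl]
    exact hv.viscosity.continuousOn.mono (prod_mono_left Icc_subset_Ici_self)
  · rw [hcl]
    exact prod_mono_left Ico_subset_Icc_self

theorem IsCauchyViscositySolution.eq_of_initial_eq {d : ℕ} {H : Space d → ℝ} (hH : Continuous H)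
    {u : Space d → ℝ} {K : ℝ≥0} (hu : LipschitzWith K u) {v w : ℝ → Space d → ℝ}
    (hv : IsCauchyViscositySolution (fun _ _ p => H p) u v)
    (hw : IsCauchyViscositySolution (fun _ _ p => H p) u w) {t : ℝ} (ht : 0 ≤ t) (x : Space d) :
    v t x = w t x := by
  have key : ∀ {v w : ℝ → Space d → ℝ}, IsCauchyViscositySolution (fun _ _ p => H p) u v →
      IsCauchyViscositySolution (fun _ _ p => H p) u w → v t x ≤ w t x := fun hv hw =>
    le_of_superjet_of_subjet hH
      (fun _ _ _ _ ht h => hv.viscosity.add_le_zero_of_hasSuperjet ht h)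
      (fun _ _ _ _ ht h => hw.viscosity.zero_le_add_of_hasSubjet ht h)
      (fun x => by rw [hv.initial, hw.initial])
      (hv.exists_lipschitzOnWith hu) (hw.exists_lipschitzOnWith hu) ht x
  exact le_antisymm (key hv hw) (key hw hv)

/-! ### Upper bound by affine solutions -/

theorem isClassicalSolution_affine {d : ℕ} (H : Space d → ℝ) (p : Space d) (c T₁ T₂ : ℝ) :
    IsClassicalSolution (fun _ _ p => H p) T₁ T₂ (fun t x => inner ℝ p x - c - t * H p) where
  contDiffOn := by
    have h1 : ContDiff ℝ 2 (fun z : ℝ × Space d => inner ℝ p z.2) :=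
      contDiff_const.inner ℝ contDiff_snd
    exact ((h1.sub contDiff_const).sub (contDiff_fst.mul contDiff_const)).contDiffOn
  equation := by
    intro t _ x
    have h1 : partialTime (fun t x => inner ℝ p x - c - t * H p) t x = -H p := by
      have h : HasDerivAt (fun τ : ℝ => inner ℝ p x - c - τ * H p) (-(1 * H p)) t :=
        ((hasDerivAt_id t).mul_const (H p)).const_sub _
      rw [one_mul] at h
      exact h.deriv
    have h2 : partialSpace (fun t x => inner ℝ p x - c - t * H p) t x = p := by
      have h : HasFDerivAt (fun y : Space d => inner ℝ p y - c - t * H p) (innerSL ℝ p) x :=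
        ((innerSL ℝ p).hasFDerivAt.sub_const c).sub_const _
      refine HasGradientAt.gradient ?_
      rw [hasGradientAt_iff_hasFDerivAt]
      exact h
    rw [h1, h2]
    ring

theorem IsResolution.apply_self {d : ℕ} {H : ℝ → Space d → Space d → ℝ} {A : ℝ}
    {R : ℝ → ℝ → LipFun d → LipFun d} (hR : IsResolution H A R) (s : ℝ) (u : LipFun d)
    (x : Space d) : (R s s u).1 x = u.1 x := by
  obtain ⟨K, hK⟩ := u.2
  have h := hR.close s s le_rfl u K hK x
  rw [sub_self, mul_zero, zero_mul] at h
  exact sub_eq_zero.1 (abs_nonpos_iff.1 h)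

theorem IsResolution.le_hopf {d : ℕ} {H : Space d → ℝ} (hH : Continuous H) {A : ℝ}
    {R : ℝ → ℝ → LipFun d → LipFun d} (hR : IsResolution (fun _ _ p => H p) A R)
    (u : LipFun d) (hconc : ConcaveOn ℝ univ u.1) {t : ℝ} (ht : 0 ≤ t) (x : Space d) :
    (R 0 t u).1 x ≤ hopf H u.1 t x := by
  obtain ⟨K, hK⟩ := u.2
  obtain ⟨p, hp, h⟩ := exists_hopf_eq hH hK hconc t x
  have hlip : ∀ τ ∈ Ioo (-1) (t + 1), ∃ K : ℝ≥0,
      LipschitzWith K (fun x : Space d => inner ℝ p x - concaveDual u.1 p - τ * H p) := by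
    intro τ _
    refine ⟨‖innerSL ℝ p‖₊, LipschitzWith.of_dist_le_mul fun y z => ?_⟩
    simpa using (innerSL ℝ p).lipschitz.dist_le_mul y z
  have hcl := hR.classical (-1) (t + 1) _
    (isClassicalSolution_affine H p (concaveDual u.1 p) (-1) (t + 1)) hlip 0 t
    ⟨by norm_num, by linarith⟩ ⟨by linarith, by linarith⟩ ht x
  rw [h, ← hcl]
  refine hR.monotone 0 t ht _ _ (fun y => ?_) x
  have := concaveDual_le hp y
  simp only [zero_mul]
  linarith

/-! ### Variational solutions -/

theorem ConcaveOn.le_add_inner_gradient {d : ℕ} {u : Space d → ℝ} (hconc : ConcaveOn ℝ univ u)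
    {z : Space d} (hz : DifferentiableAt ℝ u z) (y : Space d) :
    u y ≤ u z + inner ℝ (gradient u z) (y - z) := by
  have hline : HasDerivAt (fun s : ℝ => z + s • (y - z)) (y - z) 0 := by
    simpa using ((hasDerivAt_id (0 : ℝ)).smul_const (y - z)).const_add z
  have hg : HasFDerivAt u (fderiv ℝ u z) ((fun s : ℝ => z + s • (y - z)) 0) := by
    simpa using hz.hasFDerivAt
  have h := hg.comp_hasDerivAt (0 : ℝ) hline
  rw [gradient, InnerProductSpace.toDual_symm_apply]
  have := le_of_hasDerivAt_of_le (c := u y - u z) h ?_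
  · linarith
  · filter_upwards [Ioo_mem_nhdsGT (zero_lt_one' ℝ)] with s hs
    have h1 := hconc.2 (mem_univ z) (mem_univ y) (sub_nonneg.2 hs.2.le) hs.1.le (by ring)
    rw [show (1 - s) • z + s • y = z + s • (y - z) by rw [sub_smul, one_smul, smul_sub]; abel] at h1
    simp only [smul_eq_mul] at h1
    simp only [Function.comp, zero_smul, add_zero]
    linarith

/-- For a concave function the Clarke differential consists of supergradients. -/
theorem ConcaveOn.le_of_mem_clarkeDifferential {d : ℕ} {u : Space d → ℝ}
    (hconc : ConcaveOn ℝ univ u) (hu : Continuous u) {x p : Space d}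
    (hp : p ∈ clarkeDifferential u x) (y : Space d) : u y ≤ u x + inner ℝ p (y - x) := by
  have hconv : Convex ℝ {p : Space d | u y - u x ≤ inner ℝ p (y - x)} := by
    have := convex_halfSpace_ge (𝕜 := ℝ) (f := fun p : Space d => inner ℝ p (y - x))
      ⟨fun a b => inner_add_left _ _ _, fun c a => by simp [inner_smul_left]⟩ (u y - u x)
    exact this
  have hsub : reachableGradients u x ⊆ {p : Space d | u y - u x ≤ inner ℝ p (y - x)} := by
    rintro p ⟨z, hz, hzx, hzp⟩
    refine le_of_tendsto_of_tendsto' (b := atTop) (f := fun n => u y - u (z n))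
      (g := fun n => inner ℝ (gradient u (z n)) (y - z n)) ?_ ?_ ?_
    · exact tendsto_const_nhds.sub ((hu.tendsto x).comp hzx)
    · exact hzp.inner (tendsto_const_nhds.sub hzx)
    · intro n
      have := hconc.le_add_inner_gradient (hz n) y
      linarith
  have : u y - u x ≤ inner ℝ p (y - x) := convexHull_min hsub hconv hp
  linarith

/-- For a Hamiltonian depending on the momentum only, trajectories are straight lines with
constant momentum, and the action is that of a straight line. -/
theorem IsHamiltonianTrajectory.straight {d : ℕ} {H : Space d → ℝ} {s t : ℝ} (hst : s < t)
    {q p : ℝ → Space d} (h : IsHamiltonianTrajectory (fun _ _ p => H p) s t q p) :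
    q t = q s + (t - s) • gradient H (p s) ∧
    hamiltonianAction (fun _ _ p => H p) s t q p =
      (t - s) * (inner ℝ (p s) (gradient H (p s)) - H (p s)) := by
  have hgrad : ∀ c y, gradient (fun _ : Space d => (c : ℝ)) y = 0 := fun c y => by
    simp [gradient]
  have huniq : ∀ τ ∈ Icc s t, UniqueDiffWithinAt ℝ (Icc s t) τ := uniqueDiffOn_Icc hst
  have hp : ∀ τ ∈ Icc s t, p τ = p s := by
    refine constant_of_derivWithin_zero (fun τ hτ => (h τ hτ).2.differentiableWithinAt) ?_
    intro τ hτ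
    rw [(h τ (Ico_subset_Icc_self hτ)).2.derivWithin (huniq τ (Ico_subset_Icc_self hτ)), hgrad,
      neg_zero]
  have hq : ∀ τ ∈ Icc s t, HasDerivWithinAt q (gradient H (p s)) (Icc s t) τ := by
    intro τ hτ
    have := (h τ hτ).1
    rwa [hp τ hτ] at this
  have hd : ∀ τ ∈ Icc s t, HasDerivWithinAt (fun τ => q τ - τ • gradient H (p s)) 0 (Icc s t) τ := by
    intro τ hτ
    have h1 := (hq τ hτ).sub ((hasDerivWithinAt_id τ (Icc s t)).smul_const (gradient H (p s)))
    rw [one_smul, sub_self] at h1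
    exact h1
  constructor
  · have h1 := constant_of_derivWithin_zero (fun τ hτ => (hd τ hτ).differentiableWithinAt)
      (fun τ hτ => (hd τ (Ico_subset_Icc_self hτ)).derivWithin
        (huniq τ (Ico_subset_Icc_self hτ))) t (right_mem_Icc.2 hst.le)
    rw [sub_eq_iff_eq_add] at h1
    rw [h1, sub_smul]
    abel
  · rw [hamiltonianAction, intervalIntegral.integral_congr
      (g := fun _ => inner ℝ (p s) (gradient H (p s)) - H (p s))]
    · rw [intervalIntegral.integral_const, smul_eq_mul]
    · intro τ hτ
      rw [uIcc_of_le hst.le] at hτ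
      simp only [hp τ hτ, (hq τ hτ).derivWithin (huniq τ hτ)]

/-- Every critical value of the action is the value at `(t, x)` of one of the affine solutions
in the Hopf formula. -/
theorem IsVariationalSolution.hopf_le {d : ℕ} {H : Space d → ℝ} (hH : Continuous H)
    {u : Space d → ℝ} {K : ℝ≥0} (hu : LipschitzWith K u) (hconc : ConcaveOn ℝ univ u)
    {g : ℝ → Space d → ℝ} (hg : IsVariationalSolution (fun _ _ p => H p) 0 u g)
    {t : ℝ} (ht : 0 < t) (x : Space d) : hopf H u t x ≤ g t x := by
  obtain ⟨q, p, htraj, hqt, hp, hval⟩ := hg.critical t x ht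
  obtain ⟨hq, hact⟩ := htraj.straight ht
  have hc : ∀ y, inner ℝ (p 0) (q 0) - u (q 0) ≤ inner ℝ (p 0) y - u y := by
    intro y
    have := hconc.le_of_mem_clarkeDifferential hu.continuous hp y
    rw [inner_sub_right] at this
    linarith
  have h1 := _root_.hopf_le hH hu hconc t x (mem_dualDomain_of_forall_le hc)
  have h2 := le_concaveDual hc
  rw [hval, hact]
  rw [← hqt, hq, inner_add_right, inner_smul_right] at h1
  rw [← hqt, hq]
  linarith

/-! ### Classical solutions for short times by characteristics -/

/-- The time slab `]-τ, τ[ × ℝ^d`. -/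
def slab (d : ℕ) (τ : ℝ) : Set (ℝ × Space d) := Ioo (-τ) τ ×ˢ univ

theorem isOpen_slab (d : ℕ) (τ : ℝ) : IsOpen (slab d τ) := isOpen_Ioo.prod isOpen_univ

theorem norm_smul_sub_le_half {d : ℕ} {W : Space d → Space d} {Λ : ℝ≥0} (hW : LipschitzWith Λ W)
    {τ : ℝ} (hτ : τ * Λ ≤ 1 / 2) {t : ℝ} (ht : t ∈ Ioo (-τ) τ) (y y' : Space d) :
    ‖t • (W y - W y')‖ ≤ 1 / 2 * ‖y - y'‖ := by
  have h1 := hW.dist_le_mul y y'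
  rw [dist_eq_norm, dist_eq_norm] at h1
  rw [norm_smul, Real.norm_eq_abs]
  have h2 : |t| ≤ τ := (abs_lt.2 ht).le
  calc |t| * ‖W y - W y'‖ ≤ τ * (Λ * ‖y - y'‖) :=
        mul_le_mul h2 h1 (norm_nonneg _) ((abs_nonneg t).trans h2)
    _ = τ * Λ * ‖y - y'‖ := by ring
    _ ≤ 1 / 2 * ‖y - y'‖ := mul_le_mul_of_nonneg_right hτ (norm_nonneg _)

theorem norm_sub_le_two_mul_of_characteristics {d : ℕ} {W : Space d → Space d} {Λ : ℝ≥0}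
    (hW : LipschitzWith Λ W) {τ : ℝ} (hτ : τ * Λ ≤ 1 / 2) {t : ℝ} (ht : t ∈ Ioo (-τ) τ)
    (y y' : Space d) : ‖y - y'‖ ≤ 2 * ‖(y + t • W y) - (y' + t • W y')‖ := by
  have h1 := norm_smul_sub_le_half hW hτ ht y y'
  have h2 : ‖y - y'‖ ≤ ‖(y + t • W y) - (y' + t • W y')‖ + ‖t • (W y - W y')‖ := by
    have := norm_sub_le ((y + t • W y) - (y' + t • W y')) (t • (W y - W y'))
    rwa [show (y + t • W y) - (y' + t • W y') - t • (W y - W y') = y - y' by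
      rw [smul_sub]; abel] at this
  linarith

theorem exists_characteristic_through {d : ℕ} {W : Space d → Space d} {Λ : ℝ≥0}
    (hW : LipschitzWith Λ W) {τ : ℝ} (hτ : τ * Λ ≤ 1 / 2) {t : ℝ} (ht : t ∈ Ioo (-τ) τ)
    (x : Space d) : ∃ y, y + t • W y = x := by
  have hc : ContractingWith (1 / 2 : ℝ≥0) (fun y => x - t • W y) := by
    refine ⟨by rw [← NNReal.coe_lt_coe]; norm_num, LipschitzWith.of_dist_le_mul fun y y' => ?_⟩
    rw [dist_eq_norm, dist_eq_norm, show x - t • W y - (x - t • W y') = -(t • (W y - W y')) by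
      rw [smul_sub]; abel, norm_neg]
    simpa using norm_smul_sub_le_half hW hτ ht y y'
  refine ⟨hc.fixedPoint, ?_⟩
  have h : x - t • W hc.fixedPoint = hc.fixedPoint := hc.fixedPoint_isFixedPt
  nth_rw 1 [← h]
  abel

/-- For short times the straight characteristics `t ↦ y + t W(y)` of a Lipschitz velocity field
foliate space-time. -/
theorem exists_characteristic_homeomorph {d : ℕ} {W : Space d → Space d} {Λ : ℝ≥0}
    (hW : LipschitzWith Λ W) {τ : ℝ} (hτ : τ * Λ ≤ 1 / 2) :
    ∃ e : OpenPartialHomeomorph (ℝ × Space d) (ℝ × Space d),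
      e.source = slab d τ ∧ e.target = slab d τ ∧
      (∀ z, e z = (z.1, z.2 + z.1 • W z.2)) ∧ ∀ z, (e.symm z).1 = z.1 := by
  classical
  choose! Y hY using fun (z : ℝ × Space d) (hz : z ∈ slab d τ) =>
    exists_characteristic_through hW hτ hz.1 z.2
  have hcont : ContinuousOn (fun z : ℝ × Space d => (z.1, Y z)) (slab d τ) := by
    refine continuousOn_fst.prodMk fun z hz => ?_
    rw [ContinuousWithinAt, tendsto_iff_norm_sub_tendsto_zero]
    have hlim : Tendsto (fun z' : ℝ × Space d => 2 * ‖(z'.2 - z.2) + (z.1 - z'.1) • W (Y z)‖)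
        (𝓝[slab d τ] z) (𝓝 0) := by
      have hc : Continuous (fun z' : ℝ × Space d =>
          2 * ‖(z'.2 - z.2) + (z.1 - z'.1) • W (Y z)‖) := by fun_prop
      have := (hc.tendsto z).mono_left (nhdsWithin_le_nhds (s := slab d τ))
      simpa using this
    refine squeeze_zero' (Eventually.of_forall fun _ => norm_nonneg _) ?_ hlim
    filter_upwards [self_mem_nhdsWithin] with z' hz'
    have h1 := norm_sub_le_two_mul_of_characteristics hW hτ hz'.1 (Y z') (Y z)
    have h2 : (Y z' + z'.1 • W (Y z')) - (Y z + z'.1 • W (Y z)) =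
        (z'.2 - z.2) + (z.1 - z'.1) • W (Y z) := by
      rw [hY z' hz', show z.2 = Y z + z.1 • W (Y z) from (hY z hz).symm, sub_smul]
      abel
    rwa [h2] at h1
  refine ⟨{
    toFun := fun z => (z.1, z.2 + z.1 • W z.2)
    invFun := fun z => (z.1, Y z)
    source := slab d τ
    target := slab d τ
    map_source' := fun z hz => ⟨hz.1, trivial⟩
    map_target' := fun z hz => ⟨hz.1, trivial⟩
    left_inv' := fun z hz => ?_
    right_inv' := fun z hz => Prod.ext rfl (hY z hz)
    open_source := isOpen_slab d τ
    open_target := isOpen_slab d τ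
    continuousOn_toFun := ?_
    continuousOn_invFun := hcont }, rfl, rfl, fun _ => rfl, fun _ => rfl⟩
  · have hz' : ((z.1, z.2 + z.1 • W z.2) : ℝ × Space d) ∈ slab d τ := ⟨hz.1, trivial⟩
    have h1 := norm_sub_le_two_mul_of_characteristics hW hτ hz.1
      (Y (z.1, z.2 + z.1 • W z.2)) z.2
    have h2 := hY _ hz'
    simp only at h2
    rw [h2, sub_self, norm_zero, mul_zero] at h1
    exact Prod.ext rfl (sub_eq_zero.1 (norm_le_zero_iff.1 h1))
  · have := hW.continuous
    exact Continuous.continuousOn (by fun_prop)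

/-- The derivative of the characteristic map `(t, y) ↦ (t, y + t W(y))` is invertible for small
times, with `B = DW(y)` and `w = W(y)`. -/
theorem exists_equiv_derivative_characteristics {d : ℕ} {t : ℝ} {B : Space d →L[ℝ] Space d}
    (hB : |t| * ‖B‖ ≤ 1 / 2) (w : Space d) :
    ∃ D : (ℝ × Space d) ≃L[ℝ] (ℝ × Space d), ∀ z, D z = (z.1, z.2 + (t • B z.2 + z.1 • w)) := by
  let f : (ℝ × Space d) →ₗ[ℝ] (ℝ × Space d) :=
    { toFun := fun z => (z.1, z.2 + (t • B z.2 + z.1 • w))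
      map_add' := fun a b => by
        ext1
        · rfl
        · simp only [Prod.fst_add, Prod.snd_add, map_add, smul_add, add_smul]; abel
      map_smul' := fun c a => by
        ext1
        · rfl
        · simp only [Prod.smul_fst, Prod.smul_snd, map_smul, smul_add, RingHom.id_apply,
            smul_eq_mul, mul_smul]
          rw [smul_comm t c] }
  have hinj : Function.Injective f := by
    rw [injective_iff_map_eq_zero]
    rintro ⟨σ, v⟩ h
    have h1 : σ = 0 := congrArg Prod.fst h
    have h2 : v + (t • B v + σ • w) = 0 := congrArg Prod.snd h
    rw [h1, zero_smul, add_zero] at h2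
    have h3 : ‖v‖ ≤ 1 / 2 * ‖v‖ := by
      calc ‖v‖ = ‖t • B v‖ := by rw [← norm_neg (t • B v), ← eq_neg_of_add_eq_zero_left h2]
        _ ≤ |t| * (‖B‖ * ‖v‖) := by
          rw [norm_smul, Real.norm_eq_abs]
          exact mul_le_mul_of_nonneg_left (B.le_opNorm v) (abs_nonneg t)
        _ = |t| * ‖B‖ * ‖v‖ := by ring
        _ ≤ 1 / 2 * ‖v‖ := mul_le_mul_of_nonneg_right hB (norm_nonneg v)
    have h4 : v = 0 := norm_le_zero_iff.1 (by linarith [norm_nonneg v])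
    rw [h1, h4]
    rfl
  exact ⟨(LinearEquiv.ofInjectiveEndo f hinj).toContinuousLinearEquiv, fun z => rfl⟩

theorem hasFDerivAt_inner_gradient {d : ℕ} {f : Space d → ℝ} {x : Space d}
    (hf : DifferentiableAt ℝ f x) : HasFDerivAt f (innerSL ℝ (gradient f x)) x := by
  have := hf.hasGradientAt
  rw [hasGradientAt_iff_hasFDerivAt] at this
  exact this

theorem contDiff_gradient {d : ℕ} {f : Space d → ℝ} (hf : ContDiff ℝ 2 f) :
    ContDiff ℝ 1 (gradient f) :=
  (InnerProductSpace.toDual ℝ (Space d)).symm.contDiff.comp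
    (hf.fderiv_right (m := 1) (by norm_num))

/-- The value transported along the characteristic issued from `y`, as a function of `(t, y)`. -/
noncomputable def characteristicValue {d : ℕ} (H G : Space d → ℝ) (z : ℝ × Space d) : ℝ :=
  G z.2 + z.1 * (inner ℝ (gradient G z.2) (gradient H (gradient G z.2)) - H (gradient G z.2))

/-- The terms with `D²G` cancel: in the coordinates `x = y + t ∇H(∇G(y))` the differential of the
transported value is `-H(p) dt + p · dx`, with `p = ∇G(y)`. -/
theorem hasFDerivAt_characteristicValue {d : ℕ} {H G : Space d → ℝ} (hH : ContDiff ℝ 2 H)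
    (hG : ContDiff ℝ 2 G) {t : ℝ} {y : Space d} {D : ℝ × Space d →L[ℝ] ℝ × Space d}
    (hD : ∀ z, D z = (z.1, z.2 + (t • fderiv ℝ (fun y => gradient H (gradient G y)) y z.2
      + z.1 • gradient H (gradient G y)))) :
    HasFDerivAt (characteristicValue H G)
      ((-(H (gradient G y)) • ContinuousLinearMap.fst ℝ ℝ (Space d)
        + (innerSL ℝ (gradient G y)).comp (ContinuousLinearMap.snd ℝ ℝ (Space d))).comp D)
      (t, y) := by
  set p := gradient G y with hp
  have h1 : HasFDerivAt (gradient G) (fderiv ℝ (gradient G) y) y :=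
    ((contDiff_gradient hG).differentiable (by simp) y).hasFDerivAt
  have h2 : HasFDerivAt (fun y => gradient H (gradient G y))
      (fderiv ℝ (fun y => gradient H (gradient G y)) y) y :=
    (((contDiff_gradient hH).comp (contDiff_gradient hG)).differentiable (by simp) y).hasFDerivAt
  have h3 : HasFDerivAt G (innerSL ℝ p) y :=
    hasFDerivAt_inner_gradient (hG.differentiable (by simp) y)
  have h4 : HasFDerivAt (fun y => H (gradient G y))
      ((innerSL ℝ (gradient H p)).comp (fderiv ℝ (gradient G) y)) y :=
    HasFDerivAt.comp y (hasFDerivAt_inner_gradient (hH.differentiable (by simp) (gradient G y))) h1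
  have h5 := (h1.inner ℝ h2).sub h4
  have hsnd : HasFDerivAt (fun z : ℝ × Space d => z.2) (ContinuousLinearMap.snd ℝ ℝ (Space d))
    (t, y) := hasFDerivAt_snd
  have hfst : HasFDerivAt (fun z : ℝ × Space d => z.1) (ContinuousLinearMap.fst ℝ ℝ (Space d))
    (t, y) := hasFDerivAt_fst
  have h6 := (HasFDerivAt.comp (t, y) (f := fun z : ℝ × Space d => z.2) h3 hsnd).add
    (hfst.mul (HasFDerivAt.comp (t, y) (f := fun z : ℝ × Space d => z.2) h5 hsnd))
  refine h6.congr_fderiv ?_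
  refine ContinuousLinearMap.ext fun z => ?_
  simp only [add_apply, ContinuousLinearMap.comp_apply,
    smul_apply, sub_apply, ContinuousLinearMap.coe_fst',
    ContinuousLinearMap.coe_snd', ContinuousLinearMap.prod_apply, fderivInnerCLM_apply,
    innerSL_apply_apply, smul_eq_mul, hD, inner_add_right, inner_smul_right, Function.comp,
    Pi.sub_apply]
  rw [real_inner_comm (gradient H (gradient G y)), ← hp]
  ring

/-- Method of characteristics: if `∇H ∘ ∇G` is Lipschitz, then the Cauchy problem with initial
condition `G` at time `0` has a classical solution on a time interval around `0`. -/
theorem exists_classicalSolution {d : ℕ} {H G : Space d → ℝ} (hH : ContDiff ℝ 2 H)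
    (hG : ContDiff ℝ 2 G) {Λ L : ℝ≥0} (hW : LipschitzWith Λ (fun y => gradient H (gradient G y)))
    (hL : ∀ y, ‖gradient G y‖ ≤ L) :
    ∃ τ : ℝ, 0 < τ ∧ ∃ F : ℝ → Space d → ℝ,
      IsClassicalSolution (fun _ _ p => H p) (-τ) τ F ∧ (∀ x, F 0 x = G x) ∧
      ∀ t ∈ Ioo (-τ) τ, LipschitzWith L (F t) := by
  set τ : ℝ := 1 / (2 * (Λ + 1)) with hτdef
  have hτ0 : 0 < τ := by positivity
  have hτ : τ * Λ ≤ 1 / 2 := by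
    rw [hτdef, div_mul_eq_mul_div, one_mul, div_le_div_iff₀ (by positivity) (by norm_num)]
    linarith
  obtain ⟨e, hs, ht, he, hesymm⟩ := exists_characteristic_homeomorph hW hτ
  have hWc : ContDiff ℝ 1 (fun y => gradient H (gradient G y)) :=
    (contDiff_gradient hH).comp (contDiff_gradient hG)
  have hopen := isOpen_slab d τ
  -- the derivative of the characteristic map at the preimage of a point of the slab
  have hder : ∀ z ∈ slab d τ, ∃ D : (ℝ × Space d) ≃L[ℝ] (ℝ × Space d),
      (∀ ζ, D ζ = (ζ.1, ζ.2 + (z.1 • fderiv ℝ (fun y => gradient H (gradient G y))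
        (e.symm z).2 ζ.2 + ζ.1 • gradient H (gradient G (e.symm z).2)))) ∧
      HasFDerivAt e (D : (ℝ × Space d) →L[ℝ] (ℝ × Space d)) (e.symm z) := by
    intro z hz
    have hB : |z.1| * ‖fderiv ℝ (fun y => gradient H (gradient G y)) (e.symm z).2‖ ≤ 1 / 2 :=
      (mul_le_mul (abs_lt.2 hz.1).le (norm_fderiv_le_of_lipschitz ℝ hW) (norm_nonneg _)
        hτ0.le).trans hτ
    obtain ⟨D, hD⟩ := exists_equiv_derivative_characteristics hB
      (gradient H (gradient G (e.symm z).2))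
    refine ⟨D, hD, ?_⟩
    have hee : (e : ℝ × Space d → ℝ × Space d) =
        fun z => (z.1, z.2 + z.1 • gradient H (gradient G z.2)) := funext he
    have hsnd : HasFDerivAt (fun z : ℝ × Space d => z.2) (ContinuousLinearMap.snd ℝ ℝ (Space d))
      (e.symm z) := hasFDerivAt_snd
    have hfst : HasFDerivAt (fun z : ℝ × Space d => z.1) (ContinuousLinearMap.fst ℝ ℝ (Space d))
      (e.symm z) := hasFDerivAt_fst
    have hWd := (hWc.differentiable (by simp) (e.symm z).2).hasFDerivAt
    have h1 := hfst.prodMk (hsnd.add (hfst.smul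
      (HasFDerivAt.comp (e.symm z) (f := fun z : ℝ × Space d => z.2) hWd hsnd)))
    rw [hee]
    refine h1.congr_fderiv (ContinuousLinearMap.ext fun ζ => ?_)
    rw [ContinuousLinearEquiv.coe_coe, hD]
    simp [hesymm]
  have hecd : ContDiff ℝ 1 (e : ℝ × Space d → ℝ × Space d) := by
    rw [show (e : ℝ × Space d → ℝ × Space d) =
        fun z => (z.1, z.2 + z.1 • gradient H (gradient G z.2)) from funext he]
    exact contDiff_fst.prodMk (contDiff_snd.add (contDiff_fst.smul (hWc.comp contDiff_snd)))
  have hYc : ContDiffOn ℝ 1 (fun z => (e.symm z).2) (slab d τ) := by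
    intro z hz
    obtain ⟨D, -, hD⟩ := hder z hz
    exact (contDiff_snd.contDiffAt.comp z
      (e.contDiffAt_symm (ht ▸ hz) hD hecd.contDiffAt)).contDiffWithinAt
  -- the momentum carried by the characteristic through a point is the space gradient of the
  -- solution; being `C^1` in that point, it makes the solution `C^2`
  set P : ℝ × Space d → Space d := fun z => gradient G (e.symm z).2 with hP
  have hPc : ContDiffOn ℝ 1 P (slab d τ) := (contDiff_gradient hG).comp_contDiffOn hYc
  set ℓ : ℝ × Space d → (ℝ × Space d →L[ℝ] ℝ) := fun z =>
    -(H (P z)) • ContinuousLinearMap.fst ℝ ℝ (Space d)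
      + (innerSL ℝ (P z)).comp (ContinuousLinearMap.snd ℝ ℝ (Space d)) with hℓ
  set F : ℝ → Space d → ℝ := fun t x => characteristicValue H G (e.symm (t, x)) with hF
  have hFd : ∀ z ∈ slab d τ, HasFDerivAt (fun z : ℝ × Space d => F z.1 z.2) (ℓ z) z := by
    intro z hz
    obtain ⟨D, hDe, hD⟩ := hder z hz
    have h1 := e.hasFDerivAt_symm (ht ▸ hz) hD
    have h2 := hasFDerivAt_characteristicValue (t := z.1) (y := (e.symm z).2) hH hG
      (D := (D : (ℝ × Space d) →L[ℝ] (ℝ × Space d))) hDe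
    rw [show ((z.1, (e.symm z).2) : ℝ × Space d) = e.symm z from
      Prod.ext (hesymm z).symm rfl] at h2
    have h3 := HasFDerivAt.comp z h2 h1
    refine h3.congr_fderiv (ContinuousLinearMap.ext fun ζ => ?_)
    simp [hℓ, hP]
  have hpartial : ∀ t ∈ Ioo (-τ) τ, ∀ x, partialTime F t x = -H (P (t, x)) ∧
      partialSpace F t x = P (t, x) := by
    intro t htt x
    obtain ⟨h1, h2⟩ := partialTime_eq_and_inner_partialSpace_eq (hFd (t, x) ⟨htt, trivial⟩)
    refine ⟨by simpa [hℓ] using h1, ext_inner_right ℝ fun v => ?_⟩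
    simpa [hℓ] using h2 v
  refine ⟨τ, hτ0, F, ⟨?_, ?_⟩, ?_, ?_⟩
  · have h1 : ContDiffOn ℝ (1 + 1) (fun z : ℝ × Space d => F z.1 z.2) (slab d τ) := by
      rw [contDiffOn_succ_iff_fderiv_of_isOpen hopen]
      refine ⟨fun z hz => (hFd z hz).differentiableAt.differentiableWithinAt, by simp, ?_⟩
      have hℓc : ContDiffOn ℝ 1 ℓ (slab d τ) := by
        have c1 : ContDiffOn ℝ 1 (fun z => -(H (P z))) (slab d τ) :=
          ((hH.of_le (by norm_num)).comp_contDiffOn hPc).neg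
        have c2 : ContDiffOn ℝ 1 (fun z => innerSL ℝ (P z)) (slab d τ) :=
          (innerSL ℝ).contDiff.comp_contDiffOn hPc
        exact (c1.smul contDiffOn_const).add (c2.clm_comp contDiffOn_const)
      exact hℓc.congr fun z hz => (hFd z hz).fderiv
    rw [one_add_one_eq_two] at h1
    exact h1
  · intro t htt x
    rw [(hpartial t htt x).1, (hpartial t htt x).2]
    ring
  · intro x
    have hz : ((0, x) : ℝ × Space d) ∈ slab d τ := ⟨⟨by linarith, hτ0⟩, trivial⟩
    have h1 : e.symm (0, x) = (0, x) := by
      have h2 : e (0, x) = (0, x) := by rw [he]; simp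
      conv_lhs => rw [← h2]
      exact e.left_inv (hs ▸ hz)
    simp only [hF, h1, characteristicValue, zero_mul, add_zero]
  · intro t htt
    have hd : ∀ x, HasFDerivAt (F t) (innerSL ℝ (P (t, x))) x := by
      intro x
      have h1 : HasFDerivAt (fun y : Space d => ((t, y) : ℝ × Space d))
          (ContinuousLinearMap.inr ℝ ℝ (Space d)) x :=
        (hasFDerivAt_const t x).prodMk (hasFDerivAt_id x)
      have h2 := HasFDerivAt.comp x (hFd (t, x) ⟨htt, trivial⟩) h1
      refine h2.congr_fderiv (ContinuousLinearMap.ext fun v => ?_)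
      simp [hℓ]
    refine lipschitzWith_of_nnnorm_fderiv_le (𝕜 := ℝ) (fun x => (hd x).differentiableAt)
      fun x => ?_
    rw [(hd x).fderiv, ← NNReal.coe_le_coe, coe_nnnorm, innerSL_apply_norm]
    exact hL _

/-! ### Viscosity resolutions produce supersolutions -/

theorem HamiltonianBounds.nonneg {d : ℕ} {H : ℝ → Space d → Space d → ℝ} {A : ℝ}
    (hA : HamiltonianBounds H A) : 0 ≤ A :=
  le_trans (norm_nonneg (fderiv ℝ (fderiv ℝ
    (fun y : ℝ × Space d × Space d => H y.1 y.2.1 y.2.2)) 0)) (hA.second 0)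

theorem HamiltonianBounds.contDiff_momentum {d : ℕ} {H : Space d → ℝ} {A : ℝ}
    (hA : HamiltonianBounds (fun _ _ p => H p) A) : ContDiff ℝ 2 H :=
  hA.contDiff.comp (contDiff_const.prodMk (contDiff_const.prodMk contDiff_id) :
    ContDiff ℝ 2 (fun p : Space d => ((0, 0, p) : ℝ × Space d × Space d)))

theorem HamiltonianBounds.lipschitzWith_gradient {d : ℕ} {H : Space d → ℝ} {A : ℝ}
    (hA : HamiltonianBounds (fun _ _ p => H p) A) :
    LipschitzWith A.toNNReal (gradient H) := by
  set HH : ℝ × Space d × Space d → ℝ := fun z => H z.2.2 with hHH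
  have hlip : LipschitzWith A.toNNReal (fderiv ℝ HH) := by
    refine lipschitzWith_of_nnnorm_fderiv_le (𝕜 := ℝ)
      ((hA.contDiff.fderiv_right (m := 1) (by norm_num)).differentiable (by simp)) fun z => ?_
    rw [← NNReal.coe_le_coe, coe_nnnorm, Real.coe_toNNReal _ hA.nonneg]
    exact hA.second z
  have hder : ∀ p v, fderiv ℝ H p v = fderiv ℝ HH (0, 0, p) (0, 0, v) := by
    intro p v
    have h1 : HasFDerivAt (fun z : ℝ × Space d × Space d => z.2.2)
        ((ContinuousLinearMap.snd ℝ (Space d) (Space d)).comp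
          (ContinuousLinearMap.snd ℝ ℝ (Space d × Space d))) (0, 0, p) :=
      ((ContinuousLinearMap.snd ℝ (Space d) (Space d)).comp
          (ContinuousLinearMap.snd ℝ ℝ (Space d × Space d))).hasFDerivAt
    have h2 : HasFDerivAt H (fderiv ℝ H p) p :=
      (hA.contDiff_momentum.differentiable (by simp) p).hasFDerivAt
    have h3 : HasFDerivAt HH _ (0, 0, p) :=
      HasFDerivAt.comp ((0, 0, p) : ℝ × Space d × Space d)
        (f := fun z : ℝ × Space d × Space d => z.2.2) h2 h1
    rw [h3.fderiv]
    simp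
  refine LipschitzWith.of_dist_le_mul fun p q => ?_
  have h1 := hlip.dist_le_mul (0, 0, p) (0, 0, q)
  have h2 : dist ((0, 0, p) : ℝ × Space d × Space d) (0, 0, q) = dist p q := by
    simp [Prod.dist_eq]
  rw [h2, dist_eq_norm] at h1
  rw [gradient, gradient, LinearIsometryEquiv.dist_map, dist_eq_norm]
  refine ContinuousLinearMap.opNorm_le_bound _ (by positivity) fun v => ?_
  have h3 : (fderiv ℝ H p - fderiv ℝ H q) v =
      (fderiv ℝ HH (0, 0, p) - fderiv ℝ HH (0, 0, q)) (0, 0, v) := by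
    rw [sub_apply, sub_apply, hder, hder]
  have h4 : ‖((0, 0, v) : ℝ × Space d × Space d)‖ = ‖v‖ := by simp [Prod.norm_def]
  rw [h3]
  refine (ContinuousLinearMap.le_opNorm _ _).trans ?_
  rw [h4]
  exact mul_le_mul_of_nonneg_right h1 (norm_nonneg v)

/-- A concave function with slope `p` at `x₀` that is quadratic near `x₀` and has linear growth,
so that it is Lipschitz. -/
noncomputable def softCone {d : ℕ} (p x₀ : Space d) (M : ℝ) (x : Space d) : ℝ :=
  inner ℝ p (x - x₀) - M * (√(1 + ‖x - x₀‖ ^ 2) - 1)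

theorem contDiff_softCone {d : ℕ} (p x₀ : Space d) (M : ℝ) : ContDiff ℝ 2 (softCone p x₀ M) := by
  have h1 : ContDiff ℝ 2 (fun x : Space d => x - x₀) := contDiff_id.sub contDiff_const
  have h2 : ContDiff ℝ 2 (fun x : Space d => √(1 + ‖x - x₀‖ ^ 2)) :=
    (contDiff_const.add (h1.norm_sq ℝ)).sqrt fun x => by positivity
  exact (contDiff_const.inner ℝ h1).sub (contDiff_const.mul (h2.sub contDiff_const))

theorem gradient_softCone {d : ℕ} (p x₀ : Space d) (M : ℝ) (x : Space d) :
    gradient (softCone p x₀ M) x = p - M • ((√(1 + ‖x - x₀‖ ^ 2))⁻¹ • (x - x₀)) := by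
  have h1 : HasFDerivAt (fun x : Space d => x - x₀) (ContinuousLinearMap.id ℝ (Space d)) x :=
    (hasFDerivAt_id x).sub_const x₀
  have h2 := (h1.norm_sq.const_add 1).sqrt (by positivity)
  have h3 : HasFDerivAt (fun x : Space d => inner ℝ p (x - x₀)) (innerSL ℝ p) x :=
    HasFDerivAt.comp x (g := fun y : Space d => inner ℝ p y) (innerSL ℝ p).hasFDerivAt h1
  have h4 := h3.sub ((h2.sub_const 1).const_mul M)
  refine HasGradientAt.gradient ?_
  rw [hasGradientAt_iff_hasFDerivAt]
  refine h4.congr_fderiv (ContinuousLinearMap.ext fun v => ?_)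
  simp
  left
  ring

theorem one_le_sqrt_one_add_sq (r : ℝ) : 1 ≤ √(1 + r ^ 2) :=
  Real.one_le_sqrt.2 (by linarith [sq_nonneg r])

theorem abs_le_sqrt_one_add_sq (r : ℝ) : |r| ≤ √(1 + r ^ 2) :=
  Real.abs_le_sqrt (by linarith)

theorem norm_inv_sqrt_smul_le_one {d : ℕ} (y : Space d) :
    ‖(√(1 + ‖y‖ ^ 2))⁻¹ • y‖ ≤ 1 := by
  have h1 := one_le_sqrt_one_add_sq ‖y‖
  have h2 := abs_le_sqrt_one_add_sq ‖y‖
  rw [abs_of_nonneg (norm_nonneg y)] at h2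
  rw [norm_smul, norm_inv, Real.norm_of_nonneg (Real.sqrt_nonneg _), inv_mul_le_iff₀ (by linarith)]
  linarith

theorem lipschitzWith_inv_sqrt_smul {d : ℕ} :
    LipschitzWith 2 (fun y : Space d => (√(1 + ‖y‖ ^ 2))⁻¹ • y) := by
  refine LipschitzWith.of_dist_le_mul fun y z => ?_
  set a := √(1 + ‖y‖ ^ 2) with ha
  set b := √(1 + ‖z‖ ^ 2) with hb
  have ha1 : 1 ≤ a := one_le_sqrt_one_add_sq _
  have hb1 : 1 ≤ b := one_le_sqrt_one_add_sq _
  have hyz : |‖z‖ - ‖y‖| ≤ ‖y - z‖ := by rw [norm_sub_rev]; exact abs_norm_sub_norm_le z y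
  have hab : |b - a| ≤ ‖y - z‖ := by
    have e1 : (b - a) * (b + a) = (‖z‖ - ‖y‖) * (‖z‖ + ‖y‖) := by
      have i1 : b ^ 2 = 1 + ‖z‖ ^ 2 := Real.sq_sqrt (by positivity)
      have i2 : a ^ 2 = 1 + ‖y‖ ^ 2 := Real.sq_sqrt (by positivity)
      linear_combination i1 - i2
    have e2 : |b - a| * (b + a) = |‖z‖ - ‖y‖| * (‖z‖ + ‖y‖) := by
      have := congrArg abs e1
      rwa [abs_mul, abs_mul, abs_of_nonneg (by linarith : 0 ≤ b + a),
        abs_of_nonneg (by positivity : 0 ≤ ‖z‖ + ‖y‖)] at this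
    have e3 : ‖z‖ + ‖y‖ ≤ b + a := by
      have i1 := abs_le_sqrt_one_add_sq ‖z‖
      have i2 := abs_le_sqrt_one_add_sq ‖y‖
      rw [abs_of_nonneg (norm_nonneg _)] at i1 i2
      linarith
    refine le_trans ?_ hyz
    refine le_of_mul_le_mul_right ?_ (by linarith : 0 < b + a)
    rw [e2]
    exact mul_le_mul_of_nonneg_left e3 (abs_nonneg _)
  have e : a⁻¹ • y - b⁻¹ • z = a⁻¹ • (y - z) + (a⁻¹ * (b - a)) • (b⁻¹ • z) := by
    have : a⁻¹ * (b - a) * b⁻¹ = a⁻¹ - b⁻¹ := by field_simp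
    rw [smul_smul, this, smul_sub, sub_smul]
    abel
  have hz := norm_inv_sqrt_smul_le_one z
  rw [← hb] at hz
  have hai : a⁻¹ ≤ 1 := inv_le_one_of_one_le₀ ha1
  have hai0 : 0 ≤ a⁻¹ := by positivity
  rw [dist_eq_norm, dist_eq_norm, e]
  have h1 : ‖a⁻¹ • (y - z)‖ ≤ ‖y - z‖ := by
    rw [norm_smul, Real.norm_of_nonneg hai0]
    exact mul_le_of_le_one_left (norm_nonneg _) hai
  have h2 : ‖(a⁻¹ * (b - a)) • (b⁻¹ • z)‖ ≤ ‖y - z‖ := by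
    rw [norm_smul, Real.norm_eq_abs, abs_mul, abs_of_nonneg hai0]
    calc a⁻¹ * |b - a| * ‖b⁻¹ • z‖ ≤ a⁻¹ * |b - a| * 1 :=
          mul_le_mul_of_nonneg_left hz (by positivity)
      _ ≤ 1 * |b - a| := by rw [mul_one]; exact mul_le_mul_of_nonneg_right hai (abs_nonneg _)
      _ ≤ ‖y - z‖ := by rw [one_mul]; exact hab
  have h3 := norm_add_le (a⁻¹ • (y - z)) ((a⁻¹ * (b - a)) • (b⁻¹ • z))
  push_cast
  linarith

theorem lipschitzWith_gradient_softCone {d : ℕ} (p x₀ : Space d) (M : ℝ≥0) :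
    LipschitzWith (M * 2) (gradient (softCone p x₀ M)) := by
  refine LipschitzWith.of_dist_le_mul fun y z => ?_
  have h := (lipschitzWith_inv_sqrt_smul (d := d)).dist_le_mul (y - x₀) (z - x₀)
  rw [dist_sub_right] at h
  rw [gradient_softCone, gradient_softCone, dist_sub_left, dist_smul₀, NNReal.norm_eq]
  have := mul_le_mul_of_nonneg_left h M.2
  push_cast at this ⊢
  rw [mul_assoc]
  exact this

theorem norm_gradient_softCone_le {d : ℕ} (p x₀ : Space d) (M : ℝ≥0) (x : Space d) :
    ‖gradient (softCone p x₀ M) x‖ ≤ (‖p‖₊ + M : ℝ≥0) := by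
  rw [gradient_softCone]
  refine (norm_sub_le _ _).trans ?_
  rw [norm_smul, NNReal.norm_eq]
  push_cast
  have := mul_le_mul_of_nonneg_left (norm_inv_sqrt_smul_le_one (x - x₀)) M.2
  simp only [NNReal.val_eq_coe] at this
  linarith

/-- A local paraboloid minorant and a global Lipschitz bound combine into a soft cone minorant on
the whole space, for times close to the contact time. -/
theorem HasSubjet.exists_softCone_le {d : ℕ} {w : ℝ → Space d → ℝ} {t a : ℝ} {x p : Space d}
    (h : HasSubjet w t x a p) (ht : 0 < t) {L : ℝ} (hL : 0 ≤ L)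
    (hw : ∀ s ∈ Icc 0 t, ∀ y, w t x ≤ w s y + L * (t - s) + L * ‖y - x‖) :
    ∃ (M : ℝ≥0) (M₀ r : ℝ), 0 < r ∧ r ≤ t ∧ ∀ σ ∈ Ioo 0 r, ∀ y,
      w t x - a * σ - M₀ * σ ^ 2 + softCone p x M y ≤ w (t - σ) y := by
  obtain ⟨M₁, hM₁⟩ := h
  obtain ⟨ρ, hρ, hball⟩ := Metric.eventually_nhds_iff.1 hM₁
  set M₀ := |M₁| with hM₀
  set r := min (min ρ 1) t with hr
  have hr0 : 0 < r := by positivity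
  have hr1 : r ≤ 1 := (min_le_left _ _).trans (min_le_right _ _)
  have hrρ : r ≤ ρ := (min_le_left _ _).trans (min_le_left _ _)
  have hrt : r ≤ t := min_le_right _ _
  set M : ℝ := 3 * M₀ + 3 * (2 * L + ‖p‖ + |a|) / r with hM
  have hM0 : 0 ≤ M := by positivity
  refine ⟨⟨M, hM0⟩, M₀, r, hr0, hrt, fun σ hσ y => ?_⟩
  change w t x - a * σ - M₀ * σ ^ 2 + (inner ℝ p (y - x) - M * (√(1 + ‖y - x‖ ^ 2) - 1)) ≤ _
  set n := ‖y - x‖ with hn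
  have hn0 : 0 ≤ n := norm_nonneg _
  set S := √(1 + n ^ 2) with hS
  have hS1 : 1 ≤ S := one_le_sqrt_one_add_sq _
  have hSS : S ^ 2 = 1 + n ^ 2 := Real.sq_sqrt (by positivity)
  have hSn : S ≤ 1 + n := by nlinarith
  have hk0 : 0 ≤ 3 * (2 * L + ‖p‖ + |a|) / r := by positivity
  have hM₀0 : 0 ≤ M₀ := abs_nonneg _
  rcases lt_or_ge n r with hnr | hnr
  · -- near the contact point the paraboloid is above the soft cone
    have h1 : dist ((t - σ, y) : ℝ × Space d) (t, x) < ρ := by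
      rw [Prod.dist_eq, max_lt_iff, Real.dist_eq, dist_eq_norm]
      refine ⟨?_, hnr.trans_le hrρ⟩
      rw [show t - σ - t = -σ by ring, abs_neg, abs_of_pos hσ.1]
      exact hσ.2.trans_le hrρ
    have h2 := hball h1
    simp only at h2
    have h3 : M₁ * ((t - σ - t) ^ 2 + n ^ 2) ≤ M₀ * (σ ^ 2 + n ^ 2) := by
      rw [show (t - σ - t) ^ 2 = σ ^ 2 by ring]
      exact mul_le_mul_of_nonneg_right (le_abs_self _) (by positivity)
    have h4 : n ^ 2 ≤ 3 * (S - 1) := by nlinarith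
    have h5 : M₀ * n ^ 2 ≤ M₀ * (3 * (S - 1)) := mul_le_mul_of_nonneg_left h4 hM₀0
    have h6 : 0 ≤ 3 * (2 * L + ‖p‖ + |a|) / r * (S - 1) := mul_nonneg hk0 (by linarith)
    have h7 : M * (S - 1) = M₀ * (3 * (S - 1)) + 3 * (2 * L + ‖p‖ + |a|) / r * (S - 1) := by
      rw [hM]; ring
    rw [← hn] at h2
    linarith
  · -- far from the contact point the soft cone decreases faster than `w` can
    have h1 := hw (t - σ) ⟨by linarith [hσ.2], by linarith [hσ.1]⟩ y
    rw [← hn, sub_sub_cancel] at h1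
    have h2 : inner ℝ p (y - x) ≤ ‖p‖ * n := real_inner_le_norm _ _
    have hn2 : r * n ≤ 3 * (S - 1) := by
      have i1 : (S - 1) * (S + 1) = n ^ 2 := by linarith
      have i2 : r * (S + 1) ≤ 3 * n := by nlinarith
      have i3 : r * n * (S + 1) ≤ 3 * (S - 1) * (S + 1) := by nlinarith
      exact le_of_mul_le_mul_right i3 (by linarith)
    have h3 : (2 * L + ‖p‖ + |a|) * n ≤ 3 * (2 * L + ‖p‖ + |a|) / r * (S - 1) := by
      rw [div_mul_eq_mul_div, le_div_iff₀ hr0]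
      have := mul_le_mul_of_nonneg_left hn2 (by positivity : 0 ≤ 2 * L + ‖p‖ + |a|)
      linarith
    have h4 : M * (S - 1) = 3 * M₀ * (S - 1) + 3 * (2 * L + ‖p‖ + |a|) / r * (S - 1) := by
      rw [hM]; ring
    have h5 : 0 ≤ 3 * M₀ * (S - 1) := mul_nonneg (by positivity) (by linarith)
    have h6 : L * σ ≤ L * n := mul_le_mul_of_nonneg_left (hσ.2.le.trans hnr) hL
    have h7 : -a * σ ≤ |a| * n :=
      (mul_le_mul_of_nonneg_right (neg_le_abs a) hσ.1.le).trans
        (mul_le_mul_of_nonneg_left (hσ.2.le.trans hnr) (abs_nonneg a))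
    have h8 : 0 ≤ M₀ * σ ^ 2 := by positivity
    linarith

theorem IsClassicalSolution.translate {d : ℕ} {H : Space d → ℝ} {T₁ T₂ : ℝ}
    {f : ℝ → Space d → ℝ} (hf : IsClassicalSolution (fun _ _ p => H p) T₁ T₂ f) (s c : ℝ) :
    IsClassicalSolution (fun _ _ p => H p) (T₁ + s) (T₂ + s) (fun t x => f (t - s) x + c) where
  contDiffOn := by
    have h : ContDiff ℝ 2 (fun z : ℝ × Space d => ((z.1 - s, z.2) : ℝ × Space d)) :=
      (contDiff_fst.sub contDiff_const).prodMk contDiff_snd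
    refine (hf.contDiffOn.comp h.contDiffOn fun z hz => ?_).add contDiffOn_const
    exact ⟨⟨by linarith [hz.1.1], by linarith [hz.1.2]⟩, trivial⟩
  equation := by
    intro t ht x
    have h1 : partialTime (fun t x => f (t - s) x + c) t x = partialTime f (t - s) x := by
      simp only [partialTime, deriv_add_const]
      exact deriv_comp_sub_const (f := fun τ => f τ x) s t
    have h2 : partialSpace (fun t x => f (t - s) x + c) t x = partialSpace f (t - s) x := by
      simp only [partialSpace, gradient, fderiv_add_const]
    rw [h1, h2]
    exact hf.equation (t - s) ⟨by linarith [ht.1], by linarith [ht.2]⟩ x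

/-- Orbits are Lipschitz on bounded time intervals: the Markov property turns the bound on
`|V_s^t f - f|` into a modulus of continuity in time. -/
theorem IsViscosityResolution.exists_lipschitzOnWith {d : ℕ} {H : ℝ → Space d → Space d → ℝ}
    {A : ℝ} (hA : 0 ≤ A) {V : ℝ → ℝ → LipFun d → LipFun d} (hV : IsViscosityResolution H A V)
    (u : LipFun d) (T : ℝ) (_hT : 0 < T) : ∃ L : ℝ≥0,
    LipschitzOnWith L (fun z : ℝ × Space d => (V 0 z.1 u).1 z.2) (Ico 0 T ×ˢ univ) := by
  obtain ⟨K, hK⟩ := u.2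
  set L₁ : ℝ≥0 := ((K + 1) * Real.exp (A * T)).toNNReal with hL₁
  have hL₁c : (L₁ : ℝ) = (K + 1) * Real.exp (A * T) := Real.coe_toNNReal _ (by positivity)
  have hspace : ∀ t ∈ Ico 0 T, LipschitzWith L₁ (V 0 t u).1 := by
    intro t ht
    refine (hV.lipschitz 0 t ht.1 u K hK).weaken (Real.toNNReal_le_toNNReal ?_)
    have : Real.exp (A * (t - 0)) ≤ Real.exp (A * T) :=
      Real.exp_le_exp.2 (mul_le_mul_of_nonneg_left (by linarith [ht.2]) hA)
    have h2 := mul_le_mul_of_nonneg_left this (by positivity : (0 : ℝ) ≤ K + 1)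
    linarith
  set B : ℝ := A * ((L₁ + 1) * Real.exp (A * T)) ^ 2 with hB
  have hB0 : 0 ≤ B := by positivity
  have htime : ∀ s ∈ Ico 0 T, ∀ t ∈ Ico 0 T, s ≤ t → ∀ x,
      |(V 0 t u).1 x - (V 0 s u).1 x| ≤ B * (t - s) := by
    intro s hs t ht hst x
    have h := hV.close s t hst (V 0 s u) L₁ (hspace s hs) x
    rw [hV.markov 0 s t hs.1 hst] at h
    refine h.trans ?_
    have h1 : Real.exp (A * (t - s)) ≤ Real.exp (A * T) :=
      Real.exp_le_exp.2 (mul_le_mul_of_nonneg_left (by linarith [ht.2, hs.1]) hA)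
    have h2 : ((L₁ + 1) * Real.exp (A * (t - s))) ^ 2 ≤ ((L₁ + 1) * Real.exp (A * T)) ^ 2 :=
      pow_le_pow_left₀ (by positivity) (mul_le_mul_of_nonneg_left h1 (by positivity)) 2
    calc A * (t - s) * ((L₁ + 1) * Real.exp (A * (t - s))) ^ 2
        ≤ A * (t - s) * ((L₁ + 1) * Real.exp (A * T)) ^ 2 :=
          mul_le_mul_of_nonneg_left h2 (mul_nonneg hA (sub_nonneg.2 hst))
      _ = B * (t - s) := by rw [hB]; ring
  have htime' : ∀ s ∈ Ico 0 T, ∀ t ∈ Ico 0 T, ∀ x,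
      |(V 0 t u).1 x - (V 0 s u).1 x| ≤ B * |t - s| := by
    intro s hs t ht x
    rcases le_total s t with h | h
    · rw [abs_of_nonneg (sub_nonneg.2 h)]; exact htime s hs t ht h x
    · rw [abs_sub_comm, abs_sub_comm t s, abs_of_nonneg (sub_nonneg.2 h)]
      exact htime t ht s hs h x
  refine ⟨B.toNNReal + L₁, LipschitzOnWith.of_dist_le_mul fun z hz z' hz' => ?_⟩
  have h1 := htime' z'.1 hz'.1 z.1 hz.1 z.2
  have h2 := (hspace z'.1 hz'.1).dist_le_mul z.2 z'.2
  have h3 : |z.1 - z'.1| ≤ dist z z' := by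
    rw [← Real.dist_eq, Prod.dist_eq]; exact le_max_left _ _
  have h4 : dist z.2 z'.2 ≤ dist z z' := by
    rw [Prod.dist_eq]; exact le_max_right _ _
  push_cast
  rw [Real.coe_toNNReal _ hB0]
  rw [← Real.dist_eq] at h1
  have h5 := dist_triangle ((V 0 z.1 u).1 z.2) ((V 0 z'.1 u).1 z.2) ((V 0 z'.1 u).1 z'.2)
  have h6 := mul_le_mul_of_nonneg_left h3 hB0
  have h7 := mul_le_mul_of_nonneg_left h4 L₁.coe_nonneg
  linarith

/-- Orbits of a viscosity resolution are supersolutions: below a point of contact, the semigroup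
is compared with the classical solution issued, slightly earlier, from a soft cone. -/
theorem IsViscosityResolution.zero_le_add_of_hasSubjet {d : ℕ} {H : Space d → ℝ} {A : ℝ}
    (hA : HamiltonianBounds (fun _ _ p => H p) A) {V : ℝ → ℝ → LipFun d → LipFun d}
    (hV : IsViscosityResolution (fun _ _ p => H p) A V) (u : LipFun d) {t a : ℝ} {x p : Space d}
    (ht : 0 < t) (h : HasSubjet (fun t x => (V 0 t u).1 x) t x a p) : 0 ≤ a + H p := by
  obtain ⟨L, hL⟩ := hV.exists_lipschitzOnWith hA.nonneg u (t + 1) (by linarith)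
  have hw : ∀ s ∈ Icc 0 t, ∀ y, (V 0 t u).1 x ≤ (V 0 s u).1 y + L * (t - s) + L * ‖y - x‖ := by
    intro s hs y
    have h1 := hL.dist_le_mul (t, x) ⟨⟨ht.le, by linarith⟩, trivial⟩ (s, y)
      ⟨⟨hs.1, by linarith [hs.2]⟩, trivial⟩
    have h2 : dist ((t, x) : ℝ × Space d) (s, y) ≤ (t - s) + ‖y - x‖ := by
      rw [Prod.dist_eq, Real.dist_eq, abs_of_nonneg (sub_nonneg.2 hs.2), dist_comm, dist_eq_norm]
      exact max_le (by linarith [norm_nonneg (y - x)]) (by linarith [hs.2])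
    rw [Real.dist_eq] at h1
    have h3 := mul_le_mul_of_nonneg_left h2 L.coe_nonneg
    have h4 := le_abs_self ((V 0 t u).1 x - (V 0 s u).1 y)
    linarith
  obtain ⟨M, M₀, r, hr0, hrt, hle⟩ := h.exists_softCone_le ht L.coe_nonneg hw
  obtain ⟨τ, hτ, F, hF, hF0, hFlip⟩ := exists_classicalSolution hA.contDiff_momentum
    (contDiff_softCone p x M)
    (hA.lipschitzWith_gradient.comp (lipschitzWith_gradient_softCone p x M))
    (norm_gradient_softCone_le p x M)
  -- comparison with the classical solution over the time interval `[t - σ, t]`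
  have hcomp : ∀ σ, 0 < σ → σ < r → σ < τ → F σ x ≤ a * σ + M₀ * σ ^ 2 := by
    intro σ hσ hσr hστ
    set c := (V 0 t u).1 x - a * σ - M₀ * σ ^ 2 with hc
    have hlip : ∀ s ∈ Ioo (-τ + (t - σ)) (τ + (t - σ)), ∃ K : ℝ≥0,
        LipschitzWith K (fun y => F (s - (t - σ)) y + c) := by
      intro s hs
      refine ⟨‖p‖₊ + M, LipschitzWith.of_dist_le_mul fun y z => ?_⟩
      rw [dist_add_right]
      exact (hFlip (s - (t - σ)) ⟨by linarith [hs.1], by linarith [hs.2]⟩).dist_le_mul y z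
    have h1 := hV.classical _ _ _ (hF.translate (t - σ) c) hlip (t - σ) t
      ⟨by linarith, by linarith⟩ ⟨by linarith, by linarith⟩ (by linarith) x
    have h2 := hV.monotone (t - σ) t (by linarith)
      ⟨fun y => F (t - σ - (t - σ)) y + c, hlip (t - σ) ⟨by linarith, by linarith⟩⟩
      (V 0 (t - σ) u) (fun y => by
        have := hle σ ⟨hσ, hσr⟩ y
        simp only [sub_self, hF0]
        linarith) x
    rw [hV.markov 0 (t - σ) t (by linarith) (by linarith), h1, sub_sub_cancel] at h2
    linarith
  have hmem : Ioo (-τ) τ ×ˢ univ ∈ 𝓝 ((0, x) : ℝ × Space d) :=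
    (isOpen_slab d τ).mem_nhds ⟨⟨by linarith, hτ⟩, trivial⟩
  have hFd : DifferentiableAt ℝ (fun z : ℝ × Space d => F z.1 z.2) (0, x) :=
    (hF.contDiffOn.contDiffAt hmem).differentiableAt (by simp)
  have hgrad : partialSpace F 0 x = p := by
    rw [partialSpace, show F 0 = softCone p x M from funext hF0, gradient_softCone]
    simp
  have heq := hF.equation 0 ⟨by linarith, hτ⟩ x
  simp only [hgrad] at heq
  have hder := hasDerivAt_along_line hFd 1 0
  simp only [mul_one, inner_zero_right, add_zero, smul_zero, zero_add] at hder
  have hder2 : HasDerivAt (fun σ : ℝ => M₀ * σ ^ 2 - F σ x) (0 - partialTime F 0 x) 0 := by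
    have h1 := (hasDerivAt_pow 2 (0 : ℝ)).const_mul M₀
    norm_num at h1
    have := h1.sub hder
    exact this
  have hF00 : F 0 x = 0 := by rw [hF0]; simp [softCone]
  have := le_of_hasDerivAt_of_le (c := -a) hder2 (by
    filter_upwards [Ioo_mem_nhdsGT (lt_min hr0 hτ)] with σ hσ
    have h1 := hcomp σ hσ.1 (hσ.2.trans_le (min_le_left _ _)) (hσ.2.trans_le (min_le_right _ _))
    rw [hF00]
    linarith)
  linarith

theorem IsViscosityResolution.hopf_le {d : ℕ} {H : Space d → ℝ} {A : ℝ}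
    (hA : HamiltonianBounds (fun _ _ p => H p) A) {V : ℝ → ℝ → LipFun d → LipFun d}
    (hV : IsViscosityResolution (fun _ _ p => H p) A V) (u : LipFun d)
    (hconc : ConcaveOn ℝ univ u.1) {t : ℝ} (ht : 0 ≤ t) (x : Space d) :
    hopf H u.1 t x ≤ (V 0 t u).1 x := by
  have hH := hA.contDiff_momentum.continuous
  obtain ⟨K, hK⟩ := u.2
  refine le_of_superjet_of_subjet hH (w₂ := fun t x => (V 0 t u).1 x)
    (fun _ _ _ _ ht h => (hopf_isViscositySolution hH hK hconc).add_le_zero_of_hasSuperjet ht h)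
    (fun _ _ _ _ ht h => hV.zero_le_add_of_hasSubjet hA u ht h)
    (fun x => ?_) (fun T _ => ?_) (hV.exists_lipschitzOnWith hA.nonneg u) ht x
  · rw [hopf_zero hH hK hconc, hV.apply_self]
  · obtain ⟨L, hL⟩ := exists_lipschitzWith_hopf hH hK hconc
    exact ⟨L, hL.lipschitzOnWith⟩

/-! ### The Hopf formula for concave initial data -/

theorem corollary4 (d : ℕ) (H : Space d → ℝ) (hH : Continuous H) (u₀ : Space d → ℝ)
    (hLip : ∃ K : ℝ≥0, LipschitzWith K u₀) (hconc : ConcaveOn ℝ univ u₀) :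
    -- the infimum in the Hopf formula is a minimum
    (∀ t : ℝ, 0 ≤ t → ∀ x : Space d, IsLeast (hopfValues H u₀ t x) (hopf H u₀ t x)) ∧
    -- the Hopf formula is a viscosity solution emanating from `u₀`
    IsViscositySolution (fun _ _ p => H p) (hopf H u₀) ∧
    (∀ x : Space d, hopf H u₀ 0 x = u₀ x) ∧
    -- `v = g = u` if `H` satisfies the bounds
    (∀ A : ℝ, HamiltonianBounds (fun _ _ p => H p) A →
      IsCauchyViscositySolution (fun _ _ p => H p) u₀ (hopf H u₀) ∧
      (∀ v : ℝ → Space d → ℝ, IsCauchyViscositySolution (fun _ _ p => H p) u₀ v →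
        ∀ t : ℝ, 0 ≤ t → ∀ x : Space d, v t x = hopf H u₀ t x) ∧
      (∀ V : ℝ → ℝ → LipFun d → LipFun d, IsViscosityResolution (fun _ _ p => H p) A V →
        ∀ t : ℝ, 0 ≤ t → ∀ x : Space d, (V 0 t ⟨u₀, hLip⟩).1 x = hopf H u₀ t x) ∧
      (∀ G : ℝ → ℝ → LipFun d → LipFun d, IsVariationalResolution (fun _ _ p => H p) A G →
        ∀ t : ℝ, 0 ≤ t → ∀ x : Space d, (G 0 t ⟨u₀, hLip⟩).1 x = hopf H u₀ t x)) := by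
  obtain ⟨K, hK⟩ := id hLip
  refine ⟨fun t _ x => isLeast_hopf hH hK hconc t x, hopf_isViscositySolution hH hK hconc,
    hopf_zero hH hK hconc, fun A hA => ?_⟩
  have hcauchy := hopf_isCauchyViscositySolution hH hK hconc
  refine ⟨hcauchy, fun v hv t ht x => hv.eq_of_initial_eq hH hK hcauchy ht x,
    fun V hV t ht x => ?_, fun G hG t ht x => ?_⟩
  · exact le_antisymm (hV.le_hopf hH ⟨u₀, hLip⟩ hconc ht x)
      (hV.hopf_le hA ⟨u₀, hLip⟩ hconc ht x)
  · refine le_antisymm (hG.le_hopf hH ⟨u₀, hLip⟩ hconc ht x) ?_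
    rcases ht.eq_or_lt with rfl | ht
    · rw [hopf_zero hH hK hconc, hG.apply_self]
    · exact (hG.variational 0 ⟨u₀, hLip⟩).hopf_le hH hK hconc ht x
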